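/- Let $d\ge 1$, $h>0$, $\frac12<\kappa<1$, and let $\alpha\in\mathbb{T}^d=\mathbb{R}^d/\mathbb{Z}^d$ be rationally independent, i.e. $\langle k,\alpha\rangle\notin\mathbb{Z}$ for all $k\in\mathbb{Z}^d\setminus\{0\}$. For a continuous map $A:\mathbb{T}^d\to \mathrm{SL}(2,\mathbb{R})$ put $A(\theta;n)=A(\theta+(n-1)\alpha)\cdots A(\theta+\alpha)A(\theta)$ and $$L(\alpha,A)=\lim_{n\to\infty}\frac1n\int_{\mathbb{T}^d}\ln\|A(\theta;n)\|\,d\theta ,$$ where $\|\cdot\|$ is the operator norm, and let $\|B-A\|_0=\sup_{\theta\in\mathbb{T}^d}\|B(\theta)-A(\theta)\|$. Let $C^\omega_h(\mathbb{T}^d,\mathrm{SL}(2,\mathbb{R}))$ be the set of maps $A:\mathbb{T}^d\to\mathrm{SL}(2,\mathbb{R})$ that have a bounded holomorphic $\mathbb{Z}^d$-periodic extension to the strip $\{z\in\mathbb{C}^d:|\Im z_j|<h \text{ for all } j\}$, and let $\|\cdot\|_h$ be the supremum over this strip of the operator norm of the extension. Then for every $\epsilon>0$ there is $A\in C^\omega_h(\mathbb{T}^d,\mathrm{SL}(2,\mathbb{R}))$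 with $\|A-\mathrm{Id}\|_h<\epsilon$ at which the Lyapunov exponent is exactly $\kappa$-Hölder continuous, in the sense that $$\liminf_{\|B-A\|_0\to0}\frac{\log|L(\alpha,A)-L(\alpha,B)|}{\log\|B-A\|_0}=\kappa ,$$ where $B\ne A$ ranges over all continuous maps $\mathbb{T}^d\to\mathrm{SL}(2,\mathbb{R})$ and the quotient is $+\infty$ when $L(\alpha,B)=L(\alpha,A)$. -/

import Mathlib

open Filter Topology MeasureTheory
open scoped MatrixGroups Matrix.Norms.L2Operator

namespace QPCocycle

/-! Matrices carry the operator norm induced by the Euclidean norm (`Matrix.Norms.L2Operator`). -/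

/-- The torus `𝕋^d = ℝ^d / ℤ^d`; its `volume` is the normalized Haar measure. -/
abbrev Torus (d : ℕ) : Type := Fin d → UnitAddCircle

/-- `α ∈ ℝ^d / ℤ^d` is rationally independent: `⟨k, α⟩ ∉ ℤ` for every `k ∈ ℤ^d ∖ {0}`. -/
def RationallyIndependent {d : ℕ} (α : Torus d) : Prop :=
  ∀ k : Fin d → ℤ, k ≠ 0 → ∑ j, k j • α j ≠ 0

/-- The products `A(θ; n) = A(θ + (n-1)α) ⋯ A(θ + α) A(θ)`, with `A(θ; 0) = Id`. -/
def iter {d : ℕ} (α : Torus d) (A : C(Torus d, SL(2, ℝ))) : ℕ → Torus d → SL(2, ℝ)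
  | 0, _ => 1
  | n + 1, θ => A (θ + n • α) * iter α A n θ

/-- The integrals `∫ ln ‖A(θ; n)‖ dθ` over the torus. -/
noncomputable def logIntegral {d : ℕ} (α : Torus d) (A : C(Torus d, SL(2, ℝ))) (n : ℕ) : ℝ :=
  ∫ θ : Torus d, Real.log ‖(iter α A n θ : Matrix (Fin 2) (Fin 2) ℝ)‖

/-- The Lyapunov exponent `L(α, A) = lim (1/n) ∫ ln ‖A(θ; n)‖ dθ`
(the limit exists, see `tendsto_lyapunov`). -/
noncomputable def lyapunov {d : ℕ} (α : Torus d) (A : C(Torus d, SL(2, ℝ))) : ℝ :=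
  limUnder atTop (fun n : ℕ => (1 / (n : ℝ)) * logIntegral α A n)

/-- The uniform distance `‖B - A‖₀ = sup_θ ‖B(θ) - A(θ)‖`. -/
noncomputable def dist₀ {d : ℕ} (B A : C(Torus d, SL(2, ℝ))) : ℝ :=
  ⨆ θ : Torus d, ‖(B θ : Matrix (Fin 2) (Fin 2) ℝ) - (A θ : Matrix (Fin 2) (Fin 2) ℝ)‖

/-- The quotient `log |L(α, A) - L(α, B)| / log ‖B - A‖₀`, with values in `[-∞, ∞]` and with
`log 0 = -∞` in the numerator: it is `+∞` if `L(α, B) = L(α, A)` and `0 < ‖B - A‖₀ < 1`. -/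
noncomputable def holderQuotient {d : ℕ} (α : Torus d) (A B : C(Torus d, SL(2, ℝ))) : EReal :=
  ENNReal.log (ENNReal.ofReal |lyapunov α A - lyapunov α B|) / ((Real.log (dist₀ B A) : ℝ) : EReal)

/-- The Lyapunov exponent is exactly `κ`-Hölder continuous at `(α, A)`: the lower limit of
`log |L(α, A) - L(α, B)| / log ‖B - A‖₀` as `‖B - A‖₀ → 0`, `B ≠ A`, over all continuous
`B : 𝕋^d → SL(2, ℝ)`, equals `κ`. -/
def ExactlyHolderAt {d : ℕ} (κ : ℝ) (α : Torus d) (A : C(Torus d, SL(2, ℝ))) : Prop :=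
  liminf (fun B => holderQuotient α A B)
    (comap (fun B : C(Torus d, SL(2, ℝ)) => dist₀ B A) (𝓝[>] (0 : ℝ))) = (κ : EReal)

/-- The complex strip `{z ∈ ℂ^d : |Im z_j| < h for all j}`. -/
def strip (d : ℕ) (h : ℝ) : Set (Fin d → ℂ) := {z | ∀ j, |(z j).im| < h}

/-- `A ∈ C^ω_h(𝕋^d, SL(2, ℝ))` with (necessarily unique) extension `F`: `F` is a `ℤ^d`-periodic
bounded holomorphic matrix function on the strip that agrees with `A` on the real torus. -/
structure IsStripExtension {d : ℕ} (h : ℝ) (A : C(Torus d, SL(2, ℝ)))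
    (F : (Fin d → ℂ) → Matrix (Fin 2) (Fin 2) ℂ) : Prop where
  differentiableOn : DifferentiableOn ℂ F (strip d h)
  bounded : ∃ C : ℝ, ∀ z ∈ strip d h, ‖F z‖ ≤ C
  periodic : ∀ z ∈ strip d h, ∀ m : Fin d → ℤ, F (fun j => z j + (m j : ℂ)) = F z
  eq_on_real : ∀ x : Fin d → ℝ, F (fun j => (x j : ℂ)) =
    (A (fun j => ((x j : ℝ) : UnitAddCircle)) : Matrix (Fin 2) (Fin 2) ℝ).map Complex.ofReal

/-- `‖G‖_h = sup ‖G(z)‖` over the strip. -/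
noncomputable def stripNorm {d : ℕ} (h : ℝ)
    (G : (Fin d → ℂ) → Matrix (Fin 2) (Fin 2) ℂ) : ℝ :=
  ⨆ z : strip d h, ‖G z‖

/-! The limit that defines the Lyapunov exponent exists. -/

theorem continuous_iter {d : ℕ} (α : Torus d) (A : C(Torus d, SL(2, ℝ))) (n : ℕ) :
    Continuous (iter α A n) := by
  induction n with
  | zero => exact continuous_const
  | succ n ih =>
    exact (A.continuous.comp (continuous_id.add continuous_const)).mul ih

theorem iter_add {d : ℕ} (α : Torus d) (A : C(Torus d, SL(2, ℝ))) (m n : ℕ) (θ : Torus d) :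
    iter α A (m + n) θ = iter α A m (θ + n • α) * iter α A n θ := by
  induction m with
  | zero => simp [iter]
  | succ m ih =>
    rw [Nat.add_right_comm]
    simp only [iter]
    rw [ih, mul_assoc, add_smul, add_assoc, add_comm (m • α)]

theorem norm_SL_pos (g : SL(2, ℝ)) : 0 < ‖(g : Matrix (Fin 2) (Fin 2) ℝ)‖ := by
  rw [norm_pos_iff]
  intro h0
  have := g.det_coe
  rw [h0] at this
  simp at this

theorem one_le_norm_SL (g : SL(2, ℝ)) : 1 ≤ ‖(g : Matrix (Fin 2) (Fin 2) ℝ)‖ := by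
  set M : Matrix (Fin 2) (Fin 2) ℝ := (g : Matrix (Fin 2) (Fin 2) ℝ) with hM
  have hdet : M 0 0 * M 1 1 - M 0 1 * M 1 0 = 1 := by
    rw [← Matrix.det_fin_two]
    exact g.det_coe
  have hcol : ∀ j : Fin 2, (M 0 j) ^ 2 + (M 1 j) ^ 2 ≤ ‖M‖ ^ 2 := by
    intro j
    have h1 := Matrix.l2_opNorm_mulVec M (EuclideanSpace.single j (1 : ℝ))
    rw [PiLp.norm_single, norm_one, mul_one] at h1
    have h2 := pow_le_pow_left₀ (norm_nonneg _) h1 2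
    rw [EuclideanSpace.norm_sq_eq] at h2
    simpa [Fin.sum_univ_two] using h2
  have h0 := hcol 0
  have h1 := hcol 1
  have hn := norm_nonneg M
  nlinarith [sq_nonneg (M 0 0 - M 1 1), sq_nonneg (M 0 1 + M 1 0)]

theorem continuous_log_iter {d : ℕ} (α : Torus d) (A : C(Torus d, SL(2, ℝ))) (n : ℕ) :
    Continuous fun θ => Real.log ‖(iter α A n θ : Matrix (Fin 2) (Fin 2) ℝ)‖ := by
  refine Continuous.log ?_ fun θ => (norm_SL_pos _).ne'
  exact continuous_norm.comp (continuous_subtype_val.comp (continuous_iter α A n))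

theorem integrable_log_iter {d : ℕ} (α : Torus d) (A : C(Torus d, SL(2, ℝ))) (n : ℕ) :
    Integrable fun θ : Torus d => Real.log ‖(iter α A n θ : Matrix (Fin 2) (Fin 2) ℝ)‖ :=
  (continuous_log_iter α A n).integrable_of_hasCompactSupport (HasCompactSupport.of_compactSpace _)

theorem subadditive_logIntegral {d : ℕ} (α : Torus d) (A : C(Torus d, SL(2, ℝ))) :
    Subadditive (logIntegral α A) := by
  intro m n
  have hshift : logIntegral α A m = ∫ θ : Torus d,
      Real.log ‖(iter α A m (θ + n • α) : Matrix (Fin 2) (Fin 2) ℝ)‖ :=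
    (integral_add_right_eq_self
      (fun θ => Real.log ‖(iter α A m θ : Matrix (Fin 2) (Fin 2) ℝ)‖) (n • α)).symm
  rw [hshift, logIntegral, logIntegral, ← integral_add
    ((integrable_log_iter α A m).comp_add_right (n • α)) (integrable_log_iter α A n)]
  refine integral_mono (integrable_log_iter α A (m + n))
    (((integrable_log_iter α A m).comp_add_right (n • α)).add (integrable_log_iter α A n)) ?_
  intro θ
  simp only [iter_add]
  rw [← Real.log_mul (norm_SL_pos _).ne' (norm_SL_pos _).ne']
  refine Real.log_le_log (norm_SL_pos _) ?_
  rw [Matrix.SpecialLinearGroup.coe_mul]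
  exact norm_mul_le _ _

theorem tendsto_lyapunov {d : ℕ} (α : Torus d) (A : C(Torus d, SL(2, ℝ))) :
    Tendsto (fun n : ℕ => (1 / (n : ℝ)) * logIntegral α A n) atTop (𝓝 (lyapunov α A)) := by
  have hb : BddBelow (Set.range fun n : ℕ => logIntegral α A n / n) := by
    refine ⟨0, ?_⟩
    rintro _ ⟨n, rfl⟩
    exact div_nonneg (integral_nonneg fun θ => Real.log_nonneg (one_le_norm_SL _))
      (Nat.cast_nonneg n)
  have h := (subadditive_logIntegral α A).tendsto_lim hb
  refine tendsto_nhds_limUnder ⟨_, h.congr fun n => ?_⟩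
  rw [one_div, div_eq_inv_mul]

end QPCocycle

namespace QPCocycle

/-! The cocycle depends on one coordinate only and is a limit of cocycles `Z_j(x + a) Z_j(x)⁻¹`
conjugate to the identity (an Anosov–Katok scheme). Passing to `Z_{j+1}(x) = Z_j(x) · hyp u · rot(m
x)` inserts the constant factor `ell u φ` in the middle, where `φ` is the angle of `m a`. With `φ =
σ^κ` and `e^{2u} = σ^{κ-1}`, this factor has upper right entry of size `σ^{2κ-1}` and lower left
entry of size `σ`. As `κ > 1/2`, it tends to the identity with `σ`. Since `σ_j` is chosen after a
bound `K_j` for `Z_j` and its extension, the scheme converges on the whole strip.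

Upper bound (`lyapunov_le_of_stage`): if `B` is `δ`-close to the limit, conjugating by `Z_j · hyp t`
leaves `ell (u - t) φ` plus an error of order `K_j² e^{2t} δ`. For `δ ≤ σ_j` take `t = u`, which
leaves a rotation; for `δ ≥ σ_j` take `e^{2t} = δ^{κ-1}`. Both choices give `L(B) ≤ 3 K_j² δ^κ`.

Lower bound (`exists_hyperbolic_perturbation`): a change of size `σ_j` in the small corner of `ell u
φ` meets the large corner and raises the trace above `2 + φ²`. The matrix becomes hyperbolic with
exponent at least `φ / 2 = σ_j^κ / 2`, at distance at most `17 K_j² σ_j`.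

The field `growth` of `IsStep` makes the powers of `K_j` negligible for the Hölder exponent. The
upper bound also gives `L(A) = 0`, and `exactlyHolderAt_of_bounds` concludes. -/

/-! ### Norms of two by two matrices -/

/-- The underlying matrix of an element of `SL(2, ℝ)`. -/
abbrev mat (g : SL(2, ℝ)) : Matrix (Fin 2) (Fin 2) ℝ := g

/-- Split into diagonal and antidiagonal parts; the latter is a diagonal matrix times the unitary
swap. -/
theorem norm_fin_two_le {𝕜 : Type*} [RCLike 𝕜] (a b c d : 𝕜) {r s : ℝ}
    (ha : ‖a‖ ≤ r) (hd : ‖d‖ ≤ r) (hb : ‖b‖ ≤ s) (hc : ‖c‖ ≤ s) :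
    ‖!![a, b; c, d]‖ ≤ r + s := by
  have hr : 0 ≤ r := (norm_nonneg a).trans ha
  have hs : 0 ≤ s := (norm_nonneg b).trans hb
  have hJ : ‖(!![0, 1; 1, 0] : Matrix (Fin 2) (Fin 2) 𝕜)‖ ≤ 1 := by
    have h1 := Matrix.l2_opNorm_conjTranspose_mul_self (!![0, 1; 1, 0] : Matrix (Fin 2) (Fin 2) 𝕜)
    have h2 : (!![0, 1; 1, 0] : Matrix (Fin 2) (Fin 2) 𝕜).conjTranspose * !![0, 1; 1, 0] = 1 := by
      ext i j; fin_cases i <;> fin_cases j <;> simp [Matrix.mul_apply, Fin.sum_univ_two]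
    rw [h2, norm_one] at h1
    nlinarith [norm_nonneg (!![0, 1; 1, 0] : Matrix (Fin 2) (Fin 2) 𝕜)]
  have hsplit : !![a, b; c, d] = Matrix.diagonal ![a, d] + Matrix.diagonal ![b, c] * !![0, 1; 1, 0] := by
    ext i j; fin_cases i <;> fin_cases j <;> simp [Matrix.mul_apply, Fin.sum_univ_two]
  have h1 : ‖(Matrix.diagonal ![a, d] : Matrix (Fin 2) (Fin 2) 𝕜)‖ ≤ r := by
    rw [Matrix.l2_opNorm_diagonal, pi_norm_le_iff_of_nonneg hr]
    intro i; fin_cases i <;> simpa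
  have h2 : ‖(Matrix.diagonal ![b, c] : Matrix (Fin 2) (Fin 2) 𝕜)‖ ≤ s := by
    rw [Matrix.l2_opNorm_diagonal, pi_norm_le_iff_of_nonneg hs]
    intro i; fin_cases i <;> simpa
  rw [hsplit]
  refine (norm_add_le _ _).trans (add_le_add h1 ((norm_mul_le _ _).trans ?_))
  exact (mul_le_mul h2 hJ (norm_nonneg _) hs).trans (by rw [mul_one])

theorem norm_mat_mul_le (g k : SL(2, ℝ)) : ‖mat (g * k)‖ ≤ ‖mat g‖ * ‖mat k‖ := by
  rw [mat, Matrix.SpecialLinearGroup.coe_mul]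
  exact norm_mul_le _ _

/-! ### General estimates of the Lyapunov exponent -/

theorem lyapunov_nonneg {d : ℕ} (α : Torus d) (A : C(Torus d, SL(2, ℝ))) : 0 ≤ lyapunov α A :=
  ge_of_tendsto' (tendsto_lyapunov α A) fun n => mul_nonneg (by positivity)
    (integral_nonneg fun θ => Real.log_nonneg (one_le_norm_SL _))

theorem volume_real_univ_torus (d : ℕ) : (volume : Measure (Torus d)).real Set.univ = 1 := by
  rw [Measure.real, volume_pi, Measure.pi_univ]
  simp

theorem norm_conj_iter_le {d : ℕ} (α : Torus d) (B : C(Torus d, SL(2, ℝ)))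
    (W : Torus d → SL(2, ℝ)) {r : ℝ} (hr : 0 ≤ r)
    (hB : ∀ θ, ‖mat ((W (θ + α))⁻¹ * B θ * W θ)‖ ≤ r) (n : ℕ) (θ : Torus d) :
    ‖mat ((W (θ + n • α))⁻¹ * iter α B n θ * W θ)‖ ≤ r ^ n := by
  induction n with
  | zero => simp [iter]
  | succ n ih =>
    have h1 : (W (θ + (n + 1) • α))⁻¹ * iter α B (n + 1) θ * W θ =
        ((W (θ + n • α + α))⁻¹ * B (θ + n • α) * W (θ + n • α)) *
          ((W (θ + n • α))⁻¹ * iter α B n θ * W θ) := by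
      rw [add_smul, one_smul, ← add_assoc]
      simp only [iter]
      group
    rw [h1, pow_succ']
    exact (norm_mat_mul_le _ _).trans (mul_le_mul (hB _) ih (norm_nonneg _) hr)

theorem tendsto_affine_div (c r : ℝ) :
    Tendsto (fun n : ℕ => (1 / (n : ℝ)) * (c + n * r)) atTop (𝓝 r) := by
  have h1 : Tendsto (fun n : ℕ => c * (1 / (n : ℝ)) + r) atTop (𝓝 (c * 0 + r)) :=
    (tendsto_one_div_atTop_nhds_zero_nat.const_mul c).add_const r
  rw [mul_zero, zero_add] at h1
  refine h1.congr' ?_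
  filter_upwards [eventually_gt_atTop 0] with n hn
  have : (n : ℝ) ≠ 0 := by positivity
  field_simp

/-- If a bounded conjugation makes the cocycle bounded by `r`, then its exponent is at most
`log r`. -/
theorem lyapunov_le_log_of_conj {d : ℕ} (α : Torus d) (B : C(Torus d, SL(2, ℝ)))
    (W : Torus d → SL(2, ℝ)) {K r : ℝ} (hr : 1 ≤ r)
    (hW : ∀ θ, ‖mat (W θ)‖ ≤ K) (hW' : ∀ θ, ‖mat (W θ)⁻¹‖ ≤ K)
    (hB : ∀ θ, ‖mat ((W (θ + α))⁻¹ * B θ * W θ)‖ ≤ r) :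
    lyapunov α B ≤ Real.log r := by
  have hK : 1 ≤ K := (one_le_norm_SL _).trans (hW 0)
  have hr0 : 0 < r := by linarith
  refine le_of_tendsto_of_tendsto' (tendsto_lyapunov α B)
    (tendsto_affine_div (Real.log (K * K)) (Real.log r)) fun n => ?_
  refine mul_le_mul_of_nonneg_left ?_ (by positivity)
  have hpt : ∀ θ, Real.log ‖mat (iter α B n θ)‖ ≤ Real.log (K * K) + n * Real.log r := by
    intro θ
    rw [← Real.log_pow, ← Real.log_mul (by positivity) (by positivity)]
    refine Real.log_le_log (norm_SL_pos _) ?_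
    -- Undoing the conjugation costs the fixed factor `K * K`, whose logarithm disappears after
    -- division by `n`.
    have h1 : iter α B n θ = W (θ + n • α) * ((W (θ + n • α))⁻¹ * iter α B n θ * W θ) * (W θ)⁻¹ := by
      group
    rw [h1]
    calc _ ≤ ‖mat (W (θ + n • α))‖ * ‖mat ((W (θ + n • α))⁻¹ * iter α B n θ * W θ)‖
          * ‖mat (W θ)⁻¹‖ := (norm_mat_mul_le _ _).trans
            (mul_le_mul_of_nonneg_right (norm_mat_mul_le _ _) (norm_nonneg _))
      _ ≤ K * r ^ n * K := by
        gcongr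
        · exact hW _
        · exact norm_conj_iter_le α B W hr0.le hB n θ
        · exact hW' _
      _ = K * K * r ^ n := by ring
  calc logIntegral α B n ≤ ∫ _ : Torus d, (Real.log (K * K) + n * Real.log r) :=
        integral_mono (integrable_log_iter α B n) (integrable_const _) hpt
    _ = _ := by simp [volume_real_univ_torus]

/-- Uniform exponential growth bounds the exponent from below. -/
theorem log_le_lyapunov {d : ℕ} (α : Torus d) (B : C(Torus d, SL(2, ℝ)))
    {c r : ℝ} (hc : 0 < c) (hr : 0 < r) (hB : ∀ n θ, c * r ^ n ≤ ‖mat (iter α B n θ)‖) :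
    Real.log r ≤ lyapunov α B := by
  refine le_of_tendsto_of_tendsto' (tendsto_affine_div (Real.log c) (Real.log r))
    (tendsto_lyapunov α B) fun n => ?_
  refine mul_le_mul_of_nonneg_left ?_ (by positivity)
  calc Real.log c + n * Real.log r = ∫ _ : Torus d, (Real.log c + n * Real.log r) := by
        simp [volume_real_univ_torus]
    _ ≤ logIntegral α B n :=
        integral_mono (integrable_const _) (integrable_log_iter α B n) fun θ => by
          show _ ≤ Real.log ‖mat (iter α B n θ)‖
          rw [← Real.log_pow, ← Real.log_mul (by positivity) (by positivity)]
          exact Real.log_le_log (by positivity) (hB n θ)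

/-! ### The uniform distance -/

theorem bddAbove_norm_sub {d : ℕ} (A B : C(Torus d, SL(2, ℝ))) :
    BddAbove (Set.range fun θ : Torus d => ‖mat (B θ) - mat (A θ)‖) := by
  have hc : Continuous fun θ : Torus d => ‖mat (B θ) - mat (A θ)‖ :=
    ((continuous_subtype_val.comp B.continuous).sub
      (continuous_subtype_val.comp A.continuous)).norm
  exact (isCompact_range hc).bddAbove

theorem norm_sub_le_dist₀ {d : ℕ} (A B : C(Torus d, SL(2, ℝ))) (θ : Torus d) :
    ‖mat (B θ) - mat (A θ)‖ ≤ dist₀ B A :=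
  le_ciSup (bddAbove_norm_sub A B) θ

theorem dist₀_le {d : ℕ} (A B : C(Torus d, SL(2, ℝ))) {c : ℝ}
    (h : ∀ θ, ‖mat (B θ) - mat (A θ)‖ ≤ c) : dist₀ B A ≤ c :=
  ciSup_le h

theorem dist₀_pos {d : ℕ} {A B : C(Torus d, SL(2, ℝ))} (h : B ≠ A) : 0 < dist₀ B A := by
  obtain ⟨θ, hθ⟩ := DFunLike.ne_iff.1 h
  refine lt_of_lt_of_le (norm_pos_iff.2 (sub_ne_zero.2 fun h0 => hθ ?_)) (norm_sub_le_dist₀ A B θ)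
  exact Subtype.ext h0

/-! ### Exact Hölder continuity from two power bounds -/

/-- At a zero of the exponent, an upper power bound for all nearby cocycles and a lower power bound
for arbitrarily close ones give the exact Hölder exponent. -/
theorem exactlyHolderAt_of_bounds {d : ℕ} {κ : ℝ} (α : Torus d) (A : C(Torus d, SL(2, ℝ)))
    (hA : lyapunov α A = 0)
    (hup : ∀ c < κ, ∃ δ₀ > 0, ∀ B, 0 < dist₀ B A → dist₀ B A < δ₀ →
      lyapunov α B ≤ dist₀ B A ^ c)
    (hlow : ∀ c > κ, ∀ δ₀ > 0, ∃ B, 0 < dist₀ B A ∧ dist₀ B A < δ₀ ∧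
      dist₀ B A ^ c ≤ lyapunov α B) :
    ExactlyHolderAt κ α A := by
  have habs : ∀ B, |lyapunov α A - lyapunov α B| = lyapunov α B := fun B => by
    rw [hA, zero_sub, abs_neg, abs_of_nonneg (lyapunov_nonneg α B)]
  have hev : ∀ δ₀ > 0, ∀ᶠ B in comap (fun B : C(Torus d, SL(2, ℝ)) => dist₀ B A) (𝓝[>] (0 : ℝ)),
      0 < dist₀ B A ∧ dist₀ B A < δ₀ := fun δ₀ h0 =>
    Eventually.comap (Ioo_mem_nhdsGT h0) _
  refine le_antisymm ?_ ?_
  · refine EReal.le_of_forall_lt_iff_le.1 fun c hc => ?_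
    refine liminf_le_of_frequently_le ?_ (by isBoundedDefault)
    rw [frequently_comap]
    rw [(nhdsGT_basis (0 : ℝ)).frequently_iff]
    intro δ₀ h0
    -- Distances below `1` have negative logarithm, so the division reverses the inequality.
    obtain ⟨B, h1, h2, h3⟩ := hlow c (by exact_mod_cast hc) (min δ₀ 1) (by positivity)
    refine ⟨dist₀ B A, ⟨h1, h2.trans_le (min_le_left _ _)⟩, B, rfl, ?_⟩
    have h4 : Real.log (dist₀ B A) < 0 := Real.log_neg h1 (h2.trans_le (min_le_right _ _))
    have h5 : 0 < lyapunov α B := (Real.rpow_pos_of_pos h1 c).trans_le h3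
    rw [holderQuotient, habs, ENNReal.log_ofReal_of_pos h5, ← EReal.coe_div, EReal.coe_le_coe_iff,
      div_le_iff_of_neg h4, ← Real.log_rpow h1]
    exact Real.log_le_log (Real.rpow_pos_of_pos h1 c) h3
  · refine EReal.ge_of_forall_gt_iff_ge.1 fun c hc => ?_
    refine le_liminf_of_le (by isBoundedDefault) ?_
    obtain ⟨δ₀, h0, hB⟩ := hup c (by exact_mod_cast hc)
    filter_upwards [hev (min δ₀ 1) (by positivity)] with B hδ
    obtain ⟨h1, h2⟩ := hδ
    have h3 := hB B h1 (h2.trans_le (min_le_left _ _))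
    have h4 : Real.log (dist₀ B A) < 0 := Real.log_neg h1 (h2.trans_le (min_le_right _ _))
    rw [holderQuotient, habs]
    rcases (lyapunov_nonneg α B).eq_or_lt with h5 | h5
    · rw [← h5, ENNReal.ofReal_zero, ENNReal.log_zero,
        EReal.bot_div_of_neg_ne_bot (by exact_mod_cast h4) (EReal.coe_ne_bot _)]
      exact le_top
    · rw [ENNReal.log_ofReal_of_pos h5, ← EReal.coe_div, EReal.coe_le_coe_iff,
        le_div_iff_of_neg h4, ← Real.log_rpow h1]
      exact Real.log_le_log h5 h3

/-! ### Rotations and diagonal matrices -/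

/-- The rotation of the plane defined by a point of the unit circle. -/
noncomputable def rot : Circle →* SL(2, ℝ) where
  toFun w := ⟨!![(w : ℂ).re, -(w : ℂ).im; (w : ℂ).im, (w : ℂ).re], by
    have h := Circle.normSq_coe w
    rw [Complex.normSq_apply] at h
    rw [Matrix.det_fin_two_of]
    linarith⟩
  map_one' := by
    ext i j; fin_cases i <;> fin_cases j <;> simp
  map_mul' w v := Subtype.ext <| by
    change _ = !![(w : ℂ).re, -(w : ℂ).im; (w : ℂ).im, (w : ℂ).re] *
      !![(v : ℂ).re, -(v : ℂ).im; (v : ℂ).im, (v : ℂ).re]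
    ext i j; fin_cases i <;> fin_cases j <;>
      simp [Matrix.mul_apply, Fin.sum_univ_two] <;> ring

theorem mat_rot (w : Circle) :
    mat (rot w) = !![(w : ℂ).re, -(w : ℂ).im; (w : ℂ).im, (w : ℂ).re] := rfl

theorem continuous_rot : Continuous rot := by
  refine Continuous.subtype_mk ?_ _
  refine continuous_matrix fun i j => ?_
  have hre : Continuous fun w : Circle => (w : ℂ).re := Complex.continuous_re.comp continuous_subtype_val
  have him : Continuous fun w : Circle => (w : ℂ).im := Complex.continuous_im.comp continuous_subtype_val
  fin_cases i <;> fin_cases j <;> simp <;> first | exact hre | exact him | exact him.neg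

theorem mat_rot_exp (φ : ℝ) :
    mat (rot (Circle.exp φ)) = !![Real.cos φ, -Real.sin φ; Real.sin φ, Real.cos φ] := by
  rw [mat_rot, Circle.coe_exp, Complex.exp_ofReal_mul_I_re, Complex.exp_ofReal_mul_I_im]

theorem norm_rot_le (w : Circle) : ‖mat (rot w)‖ ≤ 1 := by
  have h1 := Matrix.l2_opNorm_conjTranspose_mul_self (mat (rot w))
  have h2 : (mat (rot w)).conjTranspose * mat (rot w) = 1 := by
    have h := Circle.normSq_coe w
    rw [Complex.normSq_apply] at h
    rw [mat_rot]
    ext i j; fin_cases i <;> fin_cases j <;>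
      simp [Matrix.mul_apply, Fin.sum_univ_two] <;> linarith
  rw [h2, norm_one] at h1
  nlinarith [norm_nonneg (mat (rot w))]

/-- The hyperbolic matrix `diag(e^u, e^{-u})`. -/
noncomputable def hyp (u : ℝ) : SL(2, ℝ) :=
  ⟨!![Real.exp u, 0; 0, Real.exp (-u)], by
    rw [Matrix.det_fin_two_of, ← Real.exp_add]; simp⟩

theorem hyp_add (u v : ℝ) : hyp (u + v) = hyp u * hyp v := by
  refine Subtype.ext ?_
  rw [Matrix.SpecialLinearGroup.coe_mul]
  ext i j; fin_cases i <;> fin_cases j <;>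
    simp [hyp, Matrix.mul_apply, Fin.sum_univ_two, Real.exp_add, mul_comm]

theorem hyp_inv (u : ℝ) : (hyp u)⁻¹ = hyp (-u) := by
  refine inv_eq_of_mul_eq_one_left ?_
  rw [← hyp_add]
  ext i j; fin_cases i <;> fin_cases j <;> simp [hyp]

theorem norm_hyp_le {u : ℝ} : ‖mat (hyp u)‖ ≤ Real.exp |u| := by
  have := norm_fin_two_le (Real.exp u) 0 0 (Real.exp (-u)) (r := Real.exp |u|) (s := 0)
    (by rw [Real.norm_of_nonneg (Real.exp_pos _).le]; exact Real.exp_le_exp.2 (le_abs_self u))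
    (by rw [Real.norm_of_nonneg (Real.exp_pos _).le]; exact Real.exp_le_exp.2 (neg_le_abs u))
    (by simp) (by simp)
  simpa [mat, hyp] using this

/-- The rotation by `φ`, seen in coordinates rescaled by `hyp u`. -/
noncomputable def ell (u φ : ℝ) : SL(2, ℝ) := hyp u * rot (Circle.exp φ) * (hyp u)⁻¹

theorem mat_ell (u φ : ℝ) : mat (ell u φ) =
    !![Real.cos φ, -(Real.exp (2 * u) * Real.sin φ);
      Real.exp (-(2 * u)) * Real.sin φ, Real.cos φ] := by
  have h := mat_rot_exp φ
  rw [mat] at h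
  have h1 : Real.exp (2 * u) = Real.exp u * Real.exp u := by rw [← Real.exp_add]; ring_nf
  have h2 : Real.exp (-(2 * u)) = Real.exp (-u) * Real.exp (-u) := by rw [← Real.exp_add]; ring_nf
  have h3 : Real.exp u * Real.exp (-u) = 1 := by rw [← Real.exp_add]; simp
  rw [ell, hyp_inv, mat, Matrix.SpecialLinearGroup.coe_mul, Matrix.SpecialLinearGroup.coe_mul, h,
    h1, h2]
  ext i j; fin_cases i <;> fin_cases j <;>
    simp [hyp, Matrix.mul_apply, Fin.sum_univ_two] <;> first | linear_combination (Real.cos φ) * h3 | ring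

/-- `hyp` is a one-parameter group. A frame `hyp t` thus undoes any chosen part of the rescaling,
and this is the freedom the upper bound uses. -/
theorem conj_ell (t u φ : ℝ) : (hyp t)⁻¹ * ell u φ * hyp t = ell (u - t) φ := by
  rw [ell, ell, hyp_inv, hyp_inv, hyp_inv, sub_eq_neg_add, hyp_add,
    show -(-t + u) = -u + t by ring, hyp_add]
  group

theorem abs_exp_mul_sin_le {u φ : ℝ} (hφ : 0 ≤ φ) {v : ℝ} (hv : v ≤ 2 * u) :
    |Real.exp v * Real.sin φ| ≤ Real.exp (2 * u) * φ := by
  rw [abs_mul, abs_of_pos (Real.exp_pos v)]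
  refine mul_le_mul (Real.exp_le_exp.2 hv) ?_ (abs_nonneg _) (Real.exp_pos _).le
  have := Real.abs_sin_le_abs (x := φ)
  rwa [abs_of_nonneg hφ] at this

theorem norm_ell_le {u φ : ℝ} (hu : 0 ≤ u) (hφ : 0 ≤ φ) :
    ‖mat (ell u φ)‖ ≤ 1 + Real.exp (2 * u) * φ := by
  rw [mat_ell]
  refine norm_fin_two_le _ _ _ _ (Real.abs_cos_le_one φ) (Real.abs_cos_le_one φ) ?_ ?_
  · rw [norm_neg]; exact abs_exp_mul_sin_le hφ le_rfl
  · exact abs_exp_mul_sin_le hφ (by linarith)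

theorem abs_cos_sub_one_le {φ : ℝ} (hφ : 0 ≤ φ) (hφ' : φ ≤ 1) : |Real.cos φ - 1| ≤ φ := by
  rw [abs_le]
  constructor
  · nlinarith [Real.one_sub_sq_div_two_le_cos (x := φ)]
  · linarith [Real.cos_le_one φ]

theorem norm_ell_sub_one_le {u φ : ℝ} (hu : 0 ≤ u) (hφ : 0 ≤ φ) (hφ' : φ ≤ 1) :
    ‖mat (ell u φ) - 1‖ ≤ 3 * (Real.exp (2 * u) * φ) := by
  have h1 : 1 ≤ Real.exp (2 * u) := Real.one_le_exp (by linarith)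
  have h2 := abs_cos_sub_one_le hφ hφ'
  have h3 : mat (ell u φ) - 1 = !![Real.cos φ - 1, -(Real.exp (2 * u) * Real.sin φ);
      Real.exp (-(2 * u)) * Real.sin φ, Real.cos φ - 1] := by
    rw [mat_ell]
    ext i j; fin_cases i <;> fin_cases j <;> simp
  rw [h3]
  refine (norm_fin_two_le _ _ _ _ h2 h2 (s := Real.exp (2 * u) * φ) ?_ ?_).trans (by nlinarith)
  · rw [norm_neg]; exact abs_exp_mul_sin_le hφ le_rfl
  · exact abs_exp_mul_sin_le hφ (by linarith)

/-! ### Complex matrices and holomorphy -/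

/-- A real unimodular matrix as a complex matrix. -/
noncomputable def cmat (g : SL(2, ℝ)) : Matrix (Fin 2) (Fin 2) ℂ := (mat g).map Complex.ofReal

theorem cmat_mul (g k : SL(2, ℝ)) : cmat (g * k) = cmat g * cmat k := by
  rw [cmat, mat, Matrix.SpecialLinearGroup.coe_mul]
  exact map_mul (Complex.ofRealHom.mapMatrix) _ _

/-- The adjugate stands in for the inverse: it is polynomial in the entries, so it stays entire with
no condition on the determinant off the real axis. -/
theorem adjugate_cmat (g : SL(2, ℝ)) : (cmat g).adjugate = cmat g⁻¹ := by
  rw [cmat, cmat, mat, mat, Matrix.SpecialLinearGroup.coe_inv]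
  exact (RingHom.map_adjugate Complex.ofRealHom _).symm

theorem norm_cmat_ell_sub_one_le {u φ : ℝ} (hu : 0 ≤ u) (hφ : 0 ≤ φ) (hφ' : φ ≤ 1) :
    ‖cmat (ell u φ) - 1‖ ≤ 3 * (Real.exp (2 * u) * φ) := by
  have h1 : 1 ≤ Real.exp (2 * u) := Real.one_le_exp (by linarith)
  have h2 := abs_cos_sub_one_le hφ hφ'
  have h3 : cmat (ell u φ) - 1 =
      !![((Real.cos φ - 1 : ℝ) : ℂ), ((-(Real.exp (2 * u) * Real.sin φ) : ℝ) : ℂ);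
        ((Real.exp (-(2 * u)) * Real.sin φ : ℝ) : ℂ), ((Real.cos φ - 1 : ℝ) : ℂ)] := by
    rw [cmat, mat_ell]
    ext i j; fin_cases i <;> fin_cases j <;> simp
  rw [h3]
  refine (norm_fin_two_le _ _ _ _ (r := φ) ?_ ?_ (s := Real.exp (2 * u) * φ) ?_ ?_).trans
    (by nlinarith)
  · rw [Complex.norm_real]; exact h2
  · rw [Complex.norm_real]; exact h2
  · rw [Complex.norm_real, norm_neg]; exact abs_exp_mul_sin_le hφ le_rfl
  · rw [Complex.norm_real]; exact abs_exp_mul_sin_le hφ (by linarith)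

/-- The rotation by a complex angle. -/
noncomputable def crot (w : ℂ) : Matrix (Fin 2) (Fin 2) ℂ :=
  !![Complex.cos w, -Complex.sin w; Complex.sin w, Complex.cos w]

theorem crot_add (w v : ℂ) : crot (w + v) = crot w * crot v := by
  ext i j; fin_cases i <;> fin_cases j <;>
    simp [crot, Matrix.mul_apply, Fin.sum_univ_two, Complex.cos_add, Complex.sin_add] <;> ring

theorem adjugate_crot (w : ℂ) : (crot w).adjugate = crot (-w) := by
  rw [crot, Matrix.adjugate_fin_two_of]
  simp [crot]

theorem crot_ofReal (φ : ℝ) : crot φ = cmat (rot (Circle.exp φ)) := by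
  rw [cmat, mat_rot_exp, crot]
  ext i j; fin_cases i <;> fin_cases j <;> simp

theorem differentiable_matrix {f : ℂ → Matrix (Fin 2) (Fin 2) ℂ}
    (h : ∀ i j, Differentiable ℂ fun z => f z i j) : Differentiable ℂ f := by
  have hf : f = fun z => ∑ i, ∑ j, f z i j • Matrix.single i j (1 : ℂ) := by
    funext z
    conv_lhs => rw [Matrix.matrix_eq_sum_single (f z)]
    simp [Matrix.smul_single]
  rw [hf]
  exact Differentiable.fun_sum fun i _ => Differentiable.fun_sum fun j _ =>
    (h i j).smul_const _

theorem differentiable_crot : Differentiable ℂ crot := by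
  refine differentiable_matrix fun i j => ?_
  have hc := Complex.differentiable_cos
  have hs := Complex.differentiable_sin
  fin_cases i <;> fin_cases j <;> simp [crot]

theorem differentiable_entry {f : ℂ → Matrix (Fin 2) (Fin 2) ℂ} (hf : Differentiable ℂ f)
    (i j : Fin 2) : Differentiable ℂ fun z => f z i j :=
  (LinearMap.toContinuousLinearMap (Matrix.entryLinearMap ℂ ℂ i j)).differentiable.comp hf

theorem differentiable_adjugate {f : ℂ → Matrix (Fin 2) (Fin 2) ℂ} (hf : Differentiable ℂ f) :
    Differentiable ℂ fun z => (f z).adjugate := by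
  refine differentiable_matrix fun i j => ?_
  have h := fun i j => differentiable_entry hf i j
  simp only [Matrix.adjugate_fin_two]
  fin_cases i <;> fin_cases j <;> simp
  · exact h 1 1
  · exact h 0 1
  · exact h 1 0
  · exact h 0 0

/-! ### Analytic conjugacies -/

/-- A continuous `SL(2, ℝ)`-valued function on the circle with a `1`-periodic entire extension. -/
structure Conjugacy where
  Z : C(UnitAddCircle, SL(2, ℝ))
  G : ℂ → Matrix (Fin 2) (Fin 2) ℂ
  differentiable : Differentiable ℂ G
  periodic : ∀ z, G (z + 1) = G z
  eq_on_real : ∀ x : ℝ, G x = cmat (Z x)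

namespace Conjugacy

/-- The trivial conjugacy. -/
noncomputable def one : Conjugacy where
  Z := 1
  G _ := 1
  differentiable := differentiable_const _
  periodic _ := rfl
  eq_on_real x := by
    ext i j; fin_cases i <;> fin_cases j <;> simp [cmat, mat]

theorem crot_periodic (m : ℤ) (z : ℂ) :
    crot (2 * Real.pi * m * (z + 1)) = crot (2 * Real.pi * m * z) := by
  have h : 2 * Real.pi * m * (z + 1) = 2 * Real.pi * m * z + m * (2 * Real.pi) := by ring
  rw [h, crot, crot, Complex.cos_add_int_mul_two_pi, Complex.sin_add_int_mul_two_pi]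

theorem crot_toCircle (m : ℤ) (x : ℝ) :
    crot (2 * Real.pi * m * x) = cmat (rot (AddCircle.toCircle (m • (x : UnitAddCircle)))) := by
  have h : (m • (x : UnitAddCircle)) = ((m * x : ℝ) : UnitAddCircle) := by
    rw [← zsmul_eq_mul, AddCircle.coe_zsmul]
  rw [h, AddCircle.toCircle_apply_mk, ← crot_ofReal]
  congr 1
  push_cast
  ring

/-- Follow a conjugacy by `diag(e^u, e^{-u})` and a rotation of degree `m`. -/
noncomputable def next (S : Conjugacy) (u : ℝ) (m : ℤ) : Conjugacy where
  Z := ⟨fun x => S.Z x * hyp u * rot (AddCircle.toCircle (m • x)),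
    (S.Z.continuous.mul continuous_const).mul
      (continuous_rot.comp (AddCircle.continuous_toCircle.comp (continuous_id.zsmul m)))⟩
  G z := S.G z * cmat (hyp u) * crot (2 * Real.pi * m * z)
  differentiable := (S.differentiable.mul (differentiable_const _)).mul
    (differentiable_crot.comp ((differentiable_const _).mul differentiable_id))
  periodic z := by
    rw [S.periodic, crot_periodic]
  eq_on_real x := by
    rw [S.eq_on_real, crot_toCircle, ← cmat_mul, ← cmat_mul]
    rfl

/-- The cocycle over `x ↦ x + a` that the conjugacy transforms to the identity. -/
noncomputable def cocycle (S : Conjugacy) (a x : UnitAddCircle) : SL(2, ℝ) :=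
  S.Z (x + a) * (S.Z x)⁻¹

/-- The entire extension of `cocycle`. -/
noncomputable def ext (S : Conjugacy) (a : ℝ) (z : ℂ) : Matrix (Fin 2) (Fin 2) ℂ :=
  S.G (z + a) * (S.G z).adjugate

theorem continuous_cocycle (S : Conjugacy) (a : UnitAddCircle) : Continuous (S.cocycle a) :=
  (S.Z.continuous.comp (continuous_id.add continuous_const)).mul S.Z.continuous.inv

theorem differentiable_ext (S : Conjugacy) (a : ℝ) : Differentiable ℂ (S.ext a) :=
  (S.differentiable.comp (differentiable_id.add (differentiable_const _))).mul
    (differentiable_adjugate S.differentiable)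

theorem ext_periodic (S : Conjugacy) (a : ℝ) (z : ℂ) : S.ext a (z + 1) = S.ext a z := by
  rw [ext, ext, add_right_comm, S.periodic, S.periodic]

theorem ext_ofReal (S : Conjugacy) (a x : ℝ) : S.ext a x = cmat (S.cocycle a x) := by
  rw [ext, ← Complex.ofReal_add, S.eq_on_real, S.eq_on_real, adjugate_cmat, ← cmat_mul]
  rfl

/-- Plane rotations commute, so the rotations by `m (x + a)` and `-m x` combine to the constant
rotation by `m a`. -/
theorem cocycle_next (S : Conjugacy) (u : ℝ) (m : ℤ) {a : UnitAddCircle} {φ : ℝ}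
    (h : AddCircle.toCircle (m • a) = Circle.exp φ) (x : UnitAddCircle) :
    (S.next u m).cocycle a x = S.Z (x + a) * ell u φ * (S.Z x)⁻¹ := by
  simp only [cocycle, next, ContinuousMap.coe_mk, smul_add, AddCircle.toCircle_add, map_mul, h, ell]
  have hc : rot (Circle.exp φ) * rot (AddCircle.toCircle (m • x)) =
      rot (AddCircle.toCircle (m • x)) * rot (Circle.exp φ) := by
    rw [← map_mul, ← map_mul, mul_comm]
  rw [← hc]
  group

theorem ext_next (S : Conjugacy) (u : ℝ) (m : ℤ) {a φ : ℝ}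
    (h : AddCircle.toCircle (m • (a : UnitAddCircle)) = Circle.exp φ) (z : ℂ) :
    (S.next u m).ext a z = S.G (z + a) * cmat (ell u φ) * (S.G z).adjugate := by
  have h1 : crot (2 * Real.pi * m * (z + a)) * crot (-(2 * Real.pi * m * z)) =
      cmat (rot (Circle.exp φ)) := by
    rw [← crot_add, ← h, ← crot_toCircle]
    congr 1
    ring
  simp only [ext, next, Matrix.adjugate_mul_distrib, adjugate_crot, adjugate_cmat]
  rw [ell, cmat_mul, cmat_mul, ← h1]
  simp only [mul_assoc]

/-- A continuous periodic function is bounded on a strip. -/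
theorem exists_bound_of_periodic {E : Type*} [NormedAddCommGroup E] {f : ℂ → E}
    (hf : Continuous f) (hp : ∀ z, f (z + 1) = f z) (h : ℝ) :
    ∃ K, ∀ z : ℂ, |z.im| < h → ‖f z‖ ≤ K := by
  have hcomp : IsCompact (Set.Icc (0 : ℝ) 1 ×ℂ Set.Icc (-h) h) :=
    isCompact_Icc.reProdIm isCompact_Icc
  obtain ⟨K, hK⟩ := hcomp.exists_bound_of_continuousOn hf.continuousOn
  refine ⟨K, fun z hz => ?_⟩
  have hper : Function.Periodic f 1 := hp
  have h1 : f (z - (⌊z.re⌋ : ℤ)) = f z := by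
    have := hper.sub_int_mul_eq (x := z) ⌊z.re⌋
    rwa [mul_one] at this
  rw [← h1]
  refine hK _ ⟨?_, ?_⟩
  · simp only [Set.mem_preimage, Complex.sub_re, Complex.intCast_re, Set.mem_Icc]
    exact ⟨sub_nonneg.2 (Int.floor_le _), by linarith [Int.lt_floor_add_one z.re]⟩
  · simp only [Set.mem_preimage, Complex.sub_im, Complex.intCast_im, sub_zero, Set.mem_Icc]
    exact ⟨by linarith [(abs_lt.1 hz).1], by linarith [(abs_lt.1 hz).2]⟩

/-- `K` bounds a conjugacy and its inverse on the circle and on a strip. -/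
structure IsBound (S : Conjugacy) (h K : ℝ) : Prop where
  one_le : 1 ≤ K
  real : ∀ x, ‖mat (S.Z x)‖ ≤ K
  real_inv : ∀ x, ‖mat (S.Z x)⁻¹‖ ≤ K
  complex : ∀ z : ℂ, |z.im| < h → ‖S.G z‖ ≤ K
  complex_adj : ∀ z : ℂ, |z.im| < h → ‖(S.G z).adjugate‖ ≤ K

theorem exists_isBound (S : Conjugacy) (h : ℝ) : ∃ K, S.IsBound h K := by
  have hZ : Continuous fun x => mat (S.Z x) := continuous_subtype_val.comp S.Z.continuous
  have hZ' : Continuous fun x => mat (S.Z x)⁻¹ := continuous_subtype_val.comp S.Z.continuous.inv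
  obtain ⟨K₁, h1⟩ := isCompact_univ.exists_bound_of_continuousOn hZ.continuousOn
  obtain ⟨K₂, h2⟩ := isCompact_univ.exists_bound_of_continuousOn hZ'.continuousOn
  obtain ⟨K₃, h3⟩ := exists_bound_of_periodic S.differentiable.continuous S.periodic h
  obtain ⟨K₄, h4⟩ := exists_bound_of_periodic (f := fun z => (S.G z).adjugate)
    (differentiable_adjugate S.differentiable).continuous (fun z => by rw [S.periodic]) h
  have hK1 : 1 ≤ K₁ := (one_le_norm_SL _).trans (h1 0 (Set.mem_univ _))
  refine ⟨K₁ + |K₂| + |K₃| + |K₄|, ?_, fun x => ?_, fun x => ?_, fun z hz => ?_, fun z hz => ?_⟩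
  · linarith [abs_nonneg K₂, abs_nonneg K₃, abs_nonneg K₄]
  · linarith [h1 x (Set.mem_univ _), abs_nonneg K₂, abs_nonneg K₃, abs_nonneg K₄]
  · linarith [h2 x (Set.mem_univ _), le_abs_self K₂, abs_nonneg K₃, abs_nonneg K₄]
  · linarith [h3 z hz, abs_nonneg K₂, le_abs_self K₃, abs_nonneg K₄]
  · linarith [h4 z hz, abs_nonneg K₂, abs_nonneg K₃, le_abs_self K₄]

end Conjugacy

/-! ### Small rotation angles -/

/-- Dirichlet's theorem gives a multiple close to `0`, and the hypothesis makes it nonzero. The sign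
of `m` is then chosen to make the angle positive. -/
theorem exists_small_angle (x : UnitAddCircle) (hx : ∀ m : ℤ, m ≠ 0 → m • x ≠ 0) {η : ℝ}
    (hη : 0 < η) : ∃ (m : ℤ) (φ : ℝ), 0 < φ ∧ φ < η ∧ AddCircle.toCircle (m • x) = Circle.exp φ := by
  obtain ⟨n, hn⟩ := exists_nat_one_div_lt (show 0 < η / (2 * Real.pi) by positivity)
  obtain ⟨j, hj, hjn⟩ := AddCircle.exists_norm_nsmul_le x (Nat.succ_pos n)
  obtain ⟨r, hr⟩ : ∃ r : ℝ, (r : UnitAddCircle) = j • x := QuotientAddGroup.mk_surjective _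
  set s : ℝ := r - round r with hs
  have hs1 : (s : UnitAddCircle) = j • x := by
    rw [← hr, hs, AddCircle.coe_sub, sub_eq_self, AddCircle.coe_eq_zero_iff]
    exact ⟨round r, by simp⟩
  have hs2 : |s| < η / (2 * Real.pi) := by
    rw [← hr, UnitAddCircle.norm_eq] at hjn
    refine lt_of_le_of_lt (hjn.trans ?_) hn
    push_cast
    gcongr
    linarith
  have hs0 : s ≠ 0 := by
    intro h0
    refine hx j (by have := hj.1; omega) ?_
    rw [natCast_zsmul, ← hs1, h0, AddCircle.coe_zero]
  have hpi := Real.pi_pos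
  rw [lt_div_iff₀ (by positivity)] at hs2
  rcases lt_or_gt_of_ne hs0 with h | h
  · rw [abs_of_neg h] at hs2
    refine ⟨-j, 2 * Real.pi * (-s), by nlinarith, by linarith, ?_⟩
    rw [neg_smul, natCast_zsmul, ← hs1, ← AddCircle.coe_neg, AddCircle.toCircle_apply_mk, div_one]
  · rw [abs_of_pos h] at hs2
    refine ⟨j, 2 * Real.pi * s, by nlinarith, by linarith, ?_⟩
    rw [natCast_zsmul, ← hs1, AddCircle.toCircle_apply_mk, div_one]

theorem norm_mul_mul_le {R : Type*} [NormedRing R] {x y z : R} {r s t : ℝ} (hx : ‖x‖ ≤ r)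
    (hy : ‖y‖ ≤ s) (hz : ‖z‖ ≤ t) : ‖x * y * z‖ ≤ r * s * t := by
  have hr := (norm_nonneg x).trans hx
  have hs := (norm_nonneg y).trans hy
  exact (norm_mul_le _ _).trans (mul_le_mul ((norm_mul_le _ _).trans
    (mul_le_mul hx hy (norm_nonneg _) hr)) hz (norm_nonneg _) (mul_nonneg hr hs))

/-! ### The inductive scheme -/

/-- The elliptic matrix of a step: the rotation by `σ ^ κ`, rescaled so that its distance to the
identity is of order `σ ^ (2 * κ - 1)`. -/
noncomputable def stepEll (κ σ : ℝ) : SL(2, ℝ) := ell ((κ - 1) / 2 * Real.log σ) (σ ^ κ)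

/-- The bound for the change of the cocycle in a step. -/
noncomputable def err (κ K σ : ℝ) : ℝ := 3 * K ^ 2 * σ ^ (2 * κ - 1)

theorem exp_two_mul_log {κ σ : ℝ} (hσ : 0 < σ) :
    Real.exp (2 * ((κ - 1) / 2 * Real.log σ)) = σ ^ (κ - 1) := by
  rw [Real.rpow_def_of_pos hσ]
  ring_nf

theorem exp_two_mul_log_mul {κ σ : ℝ} (hσ : 0 < σ) :
    Real.exp (2 * ((κ - 1) / 2 * Real.log σ)) * σ ^ κ = σ ^ (2 * κ - 1) := by
  rw [exp_two_mul_log hσ, ← Real.rpow_add hσ]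
  ring_nf

theorem log_scale_nonneg {κ σ : ℝ} (hκ : κ < 1) (hσ : 0 < σ) (hσ' : σ ≤ 1) :
    0 ≤ (κ - 1) / 2 * Real.log σ :=
  mul_nonneg_of_nonpos_of_nonpos (by linarith) (Real.log_nonpos hσ.le hσ')

theorem norm_stepEll_sub_one_le {κ σ : ℝ} (hκ : 0 < κ) (hκ' : κ < 1) (hσ : 0 < σ) (hσ' : σ ≤ 1) :
    ‖mat (stepEll κ σ) - 1‖ ≤ 3 * σ ^ (2 * κ - 1) := by
  rw [← exp_two_mul_log_mul hσ]
  exact norm_ell_sub_one_le (log_scale_nonneg hκ' hσ hσ') (Real.rpow_nonneg hσ.le _)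
    (Real.rpow_le_one hσ.le hσ' hκ.le)

theorem norm_cmat_stepEll_sub_one_le {κ σ : ℝ} (hκ : 0 < κ) (hκ' : κ < 1) (hσ : 0 < σ)
    (hσ' : σ ≤ 1) : ‖cmat (stepEll κ σ) - 1‖ ≤ 3 * σ ^ (2 * κ - 1) := by
  rw [← exp_two_mul_log_mul hσ]
  exact norm_cmat_ell_sub_one_le (log_scale_nonneg hκ' hσ hσ') (Real.rpow_nonneg hσ.le _)
    (Real.rpow_le_one hσ.le hσ' hκ.le)

/-- One step of the construction, from the conjugacy `S` to `S'`. -/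
structure IsStep (a h κ : ℝ) (j : ℕ) (S S' : Conjugacy) (σ K : ℝ) : Prop where
  isBound : S.IsBound h K
  pos : 0 < σ
  lt_one : σ < 1
  cocycle : ∀ x, S'.cocycle a x = S.Z (x + a) * stepEll κ σ * (S.Z x)⁻¹
  ext : ∀ z, S'.ext a z = S.G (z + a) * cmat (stepEll κ σ) * (S.G z).adjugate
  -- The exponent tends to `0` with `j`, so `K ^ 2` is eventually below every fixed negative power
  -- of the error.
  growth : K ^ 2 * err κ K σ ^ (1 / ((j : ℝ) + 1)) ≤ 1

theorem err_pos {κ K σ : ℝ} (hK : 1 ≤ K) (hσ : 0 < σ) : 0 < err κ K σ := by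
  have := Real.rpow_pos_of_pos hσ (2 * κ - 1)
  unfold err
  positivity

theorem tendsto_err {κ : ℝ} (hκ : 1 / 2 < κ) (K : ℝ) :
    Tendsto (fun σ => err κ K σ) (𝓝 0) (𝓝 0) := by
  have h1 : Tendsto (fun σ : ℝ => σ ^ (2 * κ - 1)) (𝓝 0) (𝓝 ((0 : ℝ) ^ (2 * κ - 1))) :=
    (Real.continuousAt_rpow_const 0 _ (Or.inr (by linarith))).tendsto
  rw [Real.zero_rpow (by linarith)] at h1
  simpa [err] using h1.const_mul (3 * K ^ 2)

/-- The order of choices matters: `K` depends on `S` alone, then a threshold for `σ` is fixed, and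
only then is an angle `φ` found among the multiples of `a`, with `σ = φ ^ κ⁻¹`. -/
theorem exists_isStep {a h κ : ℝ} (hκ : 1 / 2 < κ)
    (ha : ∀ m : ℤ, m ≠ 0 → m • (a : UnitAddCircle) ≠ 0) (j : ℕ) (S : Conjugacy) {b : ℝ}
    (hb : 0 < b) : ∃ S' σ K, IsStep a h κ j S S' σ K ∧ err κ K σ ≤ b := by
  obtain ⟨K, hK⟩ := S.exists_isBound h
  have hexp : (0 : ℝ) < 1 / ((j : ℝ) + 1) := by positivity
  have h1 := tendsto_err hκ K
  have h2 : Tendsto (fun σ => K ^ 2 * err κ K σ ^ (1 / ((j : ℝ) + 1))) (𝓝 0) (𝓝 0) := by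
    have h3 := ((Real.continuousAt_rpow_const 0 _ (Or.inr hexp.le)).tendsto.comp h1).const_mul
      (K ^ 2)
    rw [Real.zero_rpow hexp.ne', mul_zero] at h3
    exact h3
  have hev : ∀ᶠ σ in 𝓝[>] (0 : ℝ), err κ K σ < b ∧
      K ^ 2 * err κ K σ ^ (1 / ((j : ℝ) + 1)) < 1 :=
    ((h1.eventually (gt_mem_nhds hb)).and (h2.eventually (gt_mem_nhds one_pos))).filter_mono
      nhdsWithin_le_nhds
  obtain ⟨η, hη, hη'⟩ := (nhdsGT_basis (0 : ℝ)).eventually_iff.1 hev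
  have hκ0 : 0 < κ := by linarith
  have hη1 : 0 < min η 1 := lt_min hη one_pos
  obtain ⟨m, φ, hφ, hφ', hm⟩ := exists_small_angle (a : UnitAddCircle) ha
    (Real.rpow_pos_of_pos hη1 κ)
  have hσφ : (φ ^ κ⁻¹) ^ κ = φ := Real.rpow_inv_rpow hφ.le hκ0.ne'
  have hσ : 0 < φ ^ κ⁻¹ := Real.rpow_pos_of_pos hφ _
  have hσ' : φ ^ κ⁻¹ < min η 1 := by
    rw [← hσφ] at hφ'
    exact (Real.rpow_lt_rpow_iff hσ.le hη1.le hκ0).1 hφ'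
  obtain ⟨h3, h4⟩ := hη' ⟨hσ, hσ'.trans_le (min_le_left _ _)⟩
  refine ⟨S.next ((κ - 1) / 2 * Real.log (φ ^ κ⁻¹)) m, φ ^ κ⁻¹, K, ⟨hK, hσ,
    hσ'.trans_le (min_le_right _ _), fun x => ?_, fun z => ?_, h4.le⟩, h3.le⟩
  · rw [stepEll, hσφ]
    exact S.cocycle_next _ m hm x
  · rw [stepEll, hσφ]
    exact S.ext_next _ m hm z

/-- A sequence of steps with rapidly decreasing parameters. -/
structure Scheme (a h κ ε : ℝ) where
  S : ℕ → Conjugacy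
  σ : ℕ → ℝ
  K : ℕ → ℝ
  zero : S 0 = Conjugacy.one
  isStep : ∀ j, IsStep a h κ j (S j) (S (j + 1)) (σ j) (K j)
  err_zero : err κ (K 0) (σ 0) ≤ ε
  err_succ : ∀ j, err κ (K (j + 1)) (σ (j + 1)) ≤ err κ (K j) (σ j) / 2
  -- Later steps move the cocycle by less than the scale `σ j` of the hyperbolic perturbation made
  -- at stage `j`.
  err_succ' : ∀ j, err κ (K (j + 1)) (σ (j + 1)) ≤ σ j / 2

theorem nonempty_scheme {a h κ ε : ℝ} (hκ : 1 / 2 < κ) (hε : 0 < ε)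
    (ha : ∀ m : ℤ, m ≠ 0 → m • (a : UnitAddCircle) ≠ 0) : Nonempty (Scheme a h κ ε) := by
  have hstep : ∀ (j : ℕ) (p : Conjugacy × {b : ℝ // 0 < b}), ∃ S' σ K,
      IsStep a h κ j p.1 S' σ K ∧ err κ K σ ≤ p.2 := fun j p => exists_isStep hκ ha j p.1 p.2.2
  choose nx σ K hst hle using hstep
  -- The recursion carries the error allowed in the next step; the minimum secures both decay
  -- conditions.
  let seq : ℕ → Conjugacy × {b : ℝ // 0 < b} := fun n => Nat.rec (Conjugacy.one, ⟨ε, hε⟩)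
    (fun j p => (nx j p, ⟨min (err κ (K j p) (σ j p) / 2) (σ j p / 2),
      lt_min (half_pos (err_pos (hst j p).isBound.one_le (hst j p).pos)) (half_pos (hst j p).pos)⟩)) n
  exact ⟨{
    S := fun j => (seq j).1
    σ := fun j => σ j (seq j)
    K := fun j => K j (seq j)
    zero := rfl
    isStep := fun j => hst j (seq j)
    err_zero := hle 0 (seq 0)
    err_succ := fun j => (hle (j + 1) (seq (j + 1))).trans (min_le_left _ _)
    err_succ' := fun j => (hle (j + 1) (seq (j + 1))).trans (min_le_right _ _) }⟩

theorem exists_limit_of_halving {E : Type*} [NormedAddCommGroup E] [CompleteSpace E] {u : ℕ → E}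
    {e : ℕ → ℝ} (he : ∀ n, e (n + 1) ≤ e n / 2) (hu : ∀ n, ‖u (n + 1) - u n‖ ≤ e n) :
    ∃ a, ∀ n, ‖a - u n‖ ≤ 2 * e n := by
  have hgeo : ∀ j n, e (j + n) ≤ e j / 2 ^ n := by
    intro j n
    induction n with
    | zero => simp
    | succ n ih =>
      refine (he (j + n)).trans ?_
      rw [pow_succ, ← div_div]
      linarith
  have hd : ∀ j n, dist (u (j + n)) (u (j + (n + 1))) ≤ 2 * e j / 2 / 2 ^ n := by
    intro j n
    rw [dist_comm, dist_eq_norm, mul_div_cancel_left₀ _ (two_ne_zero)]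
    exact (hu (j + n)).trans (hgeo j n)
  have hc : CauchySeq u := cauchySeq_of_le_geometric_two (C := 2 * e 0) fun n => by
    simpa using hd 0 n
  obtain ⟨a, ha⟩ := cauchySeq_tendsto_of_complete hc
  refine ⟨a, fun j => ?_⟩
  have h1 := dist_le_of_le_geometric_two_of_tendsto₀ (f := fun n => u (j + n)) (hd j)
    (a := a) (by simpa [add_comm] using (tendsto_add_atTop_iff_nat j).2 ha)
  rwa [dist_comm, dist_eq_norm] at h1

/-! ### Convergence of the scheme -/

namespace Scheme

variable {a h κ ε : ℝ} (T : Scheme a h κ ε)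

/-- The size of the `j`-th step. -/
noncomputable def e (j : ℕ) : ℝ := err κ (T.K j) (T.σ j)

theorem e_pos (j : ℕ) : 0 < T.e j := err_pos (T.isStep j).isBound.one_le (T.isStep j).pos

theorem e_succ (j : ℕ) : T.e (j + 1) ≤ T.e j / 2 := T.err_succ j

theorem tendsto_e : Tendsto T.e atTop (𝓝 0) := by
  have h1 : ∀ n, T.e n ≤ T.e 0 * (1 / 2) ^ n := by
    intro n
    induction n with
    | zero => simp
    | succ n ih =>
      refine (T.e_succ n).trans ?_
      rw [pow_succ]
      linarith
  have h2 := (tendsto_pow_atTop_nhds_zero_of_lt_one (r := (1 / 2 : ℝ)) (by norm_num)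
    (by norm_num)).const_mul (T.e 0)
  rw [mul_zero] at h2
  exact squeeze_zero (fun n => (T.e_pos n).le) h1 h2

theorem norm_cocycle_sub_le (hκ : 0 < κ) (hκ' : κ < 1) (j : ℕ) (x : UnitAddCircle) :
    ‖mat ((T.S (j + 1)).cocycle a x) - mat ((T.S j).cocycle a x)‖ ≤ T.e j := by
  have hs := T.isStep j
  have h1 : mat ((T.S (j + 1)).cocycle a x) - mat ((T.S j).cocycle a x) =
      mat ((T.S j).Z (x + a)) * (mat (stepEll κ (T.σ j)) - 1) * mat ((T.S j).Z x)⁻¹ := by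
    rw [hs.cocycle, Conjugacy.cocycle]
    simp only [mat, Matrix.SpecialLinearGroup.coe_mul]
    noncomm_ring
  have h2 : T.e j = T.K j * (3 * T.σ j ^ (2 * κ - 1)) * T.K j := by rw [e, err]; ring
  rw [h1, h2]
  exact norm_mul_mul_le (hs.isBound.real _)
    (norm_stepEll_sub_one_le hκ hκ' hs.pos hs.lt_one.le) (hs.isBound.real_inv _)

theorem norm_ext_sub_le (hκ : 0 < κ) (hκ' : κ < 1) (j : ℕ) {z : ℂ} (hz : |z.im| < h) :
    ‖(T.S (j + 1)).ext a z - (T.S j).ext a z‖ ≤ T.e j := by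
  have hs := T.isStep j
  have h1 : (T.S (j + 1)).ext a z - (T.S j).ext a z =
      (T.S j).G (z + a) * (cmat (stepEll κ (T.σ j)) - 1) * ((T.S j).G z).adjugate := by
    rw [hs.ext, Conjugacy.ext]
    noncomm_ring
  have h2 : T.e j = T.K j * (3 * T.σ j ^ (2 * κ - 1)) * T.K j := by rw [e, err]; ring
  rw [h1, h2]
  exact norm_mul_mul_le (hs.isBound.complex _ (by simpa using hz))
    (norm_cmat_stepEll_sub_one_le hκ hκ' hs.pos hs.lt_one.le) (hs.isBound.complex_adj _ hz)

/-- The limit cocycle on the circle. -/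
theorem exists_limit (hκ : 0 < κ) (hκ' : κ < 1) : ∃ A : C(UnitAddCircle, SL(2, ℝ)),
    ∀ j x, ‖mat (A x) - mat ((T.S j).cocycle a x)‖ ≤ 2 * T.e j := by
  choose A hA using fun x => exists_limit_of_halving
    (u := fun j => mat ((T.S j).cocycle a x)) T.e_succ (fun j => T.norm_cocycle_sub_le hκ hκ' j x)
  have he : Tendsto (fun j => 2 * T.e j) atTop (𝓝 0) := by simpa using T.tendsto_e.const_mul 2
  have hu : TendstoUniformly (fun j x => mat ((T.S j).cocycle a x)) A atTop := by
    rw [Metric.tendstoUniformly_iff]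
    intro δ hδ
    filter_upwards [he.eventually (gt_mem_nhds hδ)] with j hj x
    rw [dist_eq_norm]
    exact (hA x j).trans_lt hj
  have hc : Continuous A := hu.continuous (Frequently.of_forall fun j =>
    continuous_subtype_val.comp ((T.S j).continuous_cocycle a))
  have hdet : ∀ x, (A x).det = 1 := by
    intro x
    have h1 : Tendsto (fun j => (mat ((T.S j).cocycle a x)).det) atTop (𝓝 (A x).det) :=
      ((continuous_id.matrix_det).tendsto (A x)).comp (hu.tendsto_at x)
    refine tendsto_nhds_unique h1 ?_
    simp only [mat, Matrix.SpecialLinearGroup.det_coe]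
    exact tendsto_const_nhds
  exact ⟨⟨fun x => ⟨A x, hdet x⟩, hc.subtype_mk _⟩, fun j x => hA x j⟩

/-- The holomorphic extension of the limit cocycle. -/
theorem exists_limit_ext (hκ : 0 < κ) (hκ' : κ < 1) (hh : 0 < h) {A : UnitAddCircle → SL(2, ℝ)}
    (hA : ∀ j x, ‖mat (A x) - mat ((T.S j).cocycle a x)‖ ≤ 2 * T.e j) :
    ∃ F : ℂ → Matrix (Fin 2) (Fin 2) ℂ, DifferentiableOn ℂ F {z | |z.im| < h} ∧
      (∀ z, |z.im| < h → ‖F z - 1‖ ≤ 2 * T.e 0) ∧ (∀ z, |z.im| < h → ∀ m : ℤ, F (z + m) = F z) ∧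
      ∀ x : ℝ, F x = cmat (A x) := by
  have hex : ∀ z : ℂ, ∃ M : Matrix (Fin 2) (Fin 2) ℂ, |z.im| < h →
      ∀ j, ‖M - (T.S j).ext a z‖ ≤ 2 * T.e j := by
    intro z
    by_cases hz : |z.im| < h
    · obtain ⟨M, hM⟩ := exists_limit_of_halving (u := fun j => (T.S j).ext a z) T.e_succ
        (fun j => T.norm_ext_sub_le hκ hκ' j hz)
      exact ⟨M, fun _ => hM⟩
    · exact ⟨0, fun h' => absurd h' hz⟩
  choose F hF using hex
  have he : Tendsto (fun j => 2 * T.e j) atTop (𝓝 0) := by simpa using T.tendsto_e.const_mul 2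
  have hu : TendstoUniformlyOn (fun j => (T.S j).ext a) F atTop {z | |z.im| < h} := by
    rw [Metric.tendstoUniformlyOn_iff]
    intro δ hδ
    filter_upwards [he.eventually (gt_mem_nhds hδ)] with j hj z hz
    rw [dist_eq_norm]
    exact (hF z hz j).trans_lt hj
  have hopen : IsOpen {z : ℂ | |z.im| < h} :=
    isOpen_lt (continuous_abs.comp Complex.continuous_im) continuous_const
  refine ⟨F, hu.tendstoLocallyUniformlyOn.differentiableOn
    (Eventually.of_forall fun j => ((T.S j).differentiable_ext a).differentiableOn) hopen,
    fun z hz => ?_, fun z hz m => ?_, fun x => ?_⟩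
  · have h1 := hF z hz 0
    rwa [T.zero, Conjugacy.ext, Conjugacy.one, Matrix.adjugate_one, mul_one] at h1
  · have hz' : |(z + m).im| < h := by simpa using hz
    refine tendsto_nhds_unique (hu.tendsto_at hz') ?_
    refine (hu.tendsto_at hz).congr fun j => ?_
    have hp : Function.Periodic ((T.S j).ext a) 1 := (T.S j).ext_periodic a
    have := hp.int_mul m z
    rw [mul_one] at this
    exact this.symm
  · have hx : |(x : ℂ).im| < h := by simpa using hh
    refine tendsto_nhds_unique (hu.tendsto_at hx) ?_
    simp only [Conjugacy.ext_ofReal]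
    have h1 : Tendsto (fun j => mat ((T.S j).cocycle a x)) atTop (𝓝 (mat (A x))) := by
      rw [tendsto_iff_norm_sub_tendsto_zero]
      refine squeeze_zero (fun _ => norm_nonneg _) (fun j => ?_) he
      rw [norm_sub_rev]
      exact hA j x
    exact ((continuous_id.matrix_map Complex.continuous_ofReal).tendsto _).comp h1

end Scheme

/-! ### Powers of a hyperbolic matrix -/

/-- The larger eigenvalue `ρ` is real and at least `1 + φ`, because `t ^ 2 - 4 ≥ 4 φ ^ 2`. Its
eigenvector is stretched by `ρ ^ n`. -/
theorem pow_le_norm_pow_of_trace {g : SL(2, ℝ)} {φ : ℝ} (hφ : 0 ≤ φ)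
    (hg : 2 + φ ^ 2 ≤ g 0 0 + g 1 1) (n : ℕ) : (1 + φ) ^ n ≤ ‖mat (g ^ n)‖ := by
  set t : ℝ := g 0 0 + g 1 1 with ht
  have hdet : g 0 0 * g 1 1 - g 0 1 * g 1 0 = 1 := by
    rw [← Matrix.det_fin_two]
    exact g.det_coe
  set ρ : ℝ := (t + Real.sqrt (t ^ 2 - 4)) / 2 with hρ
  have hsq : Real.sqrt (t ^ 2 - 4) ^ 2 = t ^ 2 - 4 := Real.sq_sqrt (by nlinarith)
  have hroot : ρ ^ 2 - t * ρ + 1 = 0 := by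
    rw [hρ]
    linear_combination hsq / 4
  have hlow : 1 + φ ≤ ρ := by
    have : 2 * φ ≤ Real.sqrt (t ^ 2 - 4) := Real.le_sqrt_of_sq_le (by nlinarith)
    rw [hρ]
    nlinarith
  have hdet' : (mat g - Matrix.scalar (Fin 2) ρ).det = 0 := by
    rw [Matrix.det_fin_two]
    simp
    linear_combination hroot + hdet + ρ * ht
  obtain ⟨v, hv0, hv⟩ := Matrix.exists_mulVec_eq_zero_iff.2 hdet'
  have hev : (mat g).mulVec v = ρ • v := by
    rw [Matrix.sub_mulVec, sub_eq_zero] at hv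
    rw [hv]
    ext i
    simp [Matrix.mulVec_diagonal]
  have hpow : ∀ n : ℕ, (mat (g ^ n)).mulVec v = ρ ^ n • v := by
    intro n
    induction n with
    | zero => simp [mat]
    | succ n ih =>
      rw [pow_succ, mat, Matrix.SpecialLinearGroup.coe_mul, ← Matrix.mulVec_mulVec]
      change (mat (g ^ n)).mulVec ((mat g).mulVec v) = _
      rw [hev, Matrix.mulVec_smul, ih, smul_smul, pow_succ, mul_comm]
  have h1 := Matrix.l2_opNorm_mulVec (mat (g ^ n)) (WithLp.toLp 2 v)
  have h2 : 0 < ‖(WithLp.toLp 2 v : EuclideanSpace ℝ (Fin 2))‖ := by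
    rw [norm_pos_iff]
    intro h0
    exact hv0 (by simpa using h0)
  have h3 : (1 + φ) ^ n ≤ ρ ^ n := pow_le_pow_left₀ (by linarith) hlow n
  have h4 : ‖ρ ^ n • (WithLp.toLp 2 v : EuclideanSpace ℝ (Fin 2))‖ ≤
      ‖mat (g ^ n)‖ * ‖(WithLp.toLp 2 v : EuclideanSpace ℝ (Fin 2))‖ := by
    refine le_trans (le_of_eq ?_) h1
    rw [← WithLp.toLp_smul, ← hpow n]
    rfl
  rw [norm_smul, Real.norm_eq_abs] at h4
  exact h3.trans ((le_abs_self _).trans (le_of_mul_le_mul_right h4 h2))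

/-- The lower triangular unipotent matrix. -/
def lower (y : ℝ) : SL(2, ℝ) := ⟨!![1, 0; y, 1], by simp [Matrix.det_fin_two_of]⟩

theorem norm_lower_sub_one_le {y : ℝ} : ‖mat (lower y) - 1‖ ≤ |y| := by
  have h1 : mat (lower y) - 1 = !![0, 0; y, 0] := by
    change !![1, 0; y, 1] - 1 = _
    ext i j; fin_cases i <;> fin_cases j <;> simp
  rw [h1]
  have := norm_fin_two_le (0 : ℝ) 0 y 0 (r := 0) (s := |y|) (by simp) (by simp) (by simp) le_rfl
  rwa [zero_add] at this

/-- The corner `-σ ^ (κ - 1) sin φ` times `-4 σ` contributes `4 φ sin φ`, about `4 φ ^ 2`. This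
outweighs the loss of at most `φ ^ 2` in `2 cos φ`, with room for the cubic error of the sine. -/
theorem trace_stepEll_mul_lower {κ σ : ℝ} (hκ : 0 < κ) (hσ : 0 < σ) (hσ' : σ ≤ 1) :
    2 + (σ ^ κ) ^ 2 ≤ (stepEll κ σ * lower (-4 * σ)) 0 0 + (stepEll κ σ * lower (-4 * σ)) 1 1 := by
  have hφ : 0 < σ ^ κ := Real.rpow_pos_of_pos hσ κ
  have hφ' : σ ^ κ ≤ 1 := Real.rpow_le_one hσ.le hσ' hκ.le
  have h0 : σ ^ (κ - 1) * σ = σ ^ κ := by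
    rw [← Real.rpow_add_one hσ.ne']
    ring_nf
  have h1 : mat (stepEll κ σ * lower (-4 * σ)) = mat (stepEll κ σ) * !![1, 0; -4 * σ, 1] := by
    rw [mat, Matrix.SpecialLinearGroup.coe_mul]
    rfl
  change _ ≤ mat (stepEll κ σ * lower (-4 * σ)) 0 0 + mat (stepEll κ σ * lower (-4 * σ)) 1 1
  rw [h1, stepEll, mat_ell, exp_two_mul_log hσ]
  set φ := σ ^ κ
  have h2 : φ - φ ^ 3 / 6 < Real.sin φ := Real.sin_gt_sub_cube hφ
  have h3 := Real.one_sub_sq_div_two_le_cos (x := φ)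
  simp [Matrix.mul_apply, Fin.sum_univ_two]
  have h4 : σ ^ (κ - 1) * Real.sin φ * (4 * σ) = 4 * φ * Real.sin φ := by
    rw [← h0]; ring
  rw [h4]
  nlinarith [mul_pos hφ (sub_pos.2 h2), pow_le_one₀ hφ.le hφ' (n := 2), pow_pos hφ 2]

namespace Scheme

variable {d : ℕ} {a h κ ε : ℝ} (T : Scheme a h κ ε)

theorem e_antitone : Antitone T.e :=
  antitone_nat_of_succ_le fun n => (T.e_succ n).trans (half_le_self (T.e_pos n).le)

/-! ### The upper bound -/

section Upper

variable {α : Torus d} {i : Fin d} {A : UnitAddCircle → SL(2, ℝ)} {B : C(Torus d, SL(2, ℝ))} {δ : ℝ}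

/-- The parameter `t` trades the norm of the remaining elliptic matrix against the magnification
`e^{2t}` of the perturbation. The frame uses `Z_j`, hence only `K j`, although `B` is compared with
stage `j + 1`. -/
theorem lyapunov_le_of_frame (hα : (a : UnitAddCircle) = α i)
    (hA : ∀ j x, ‖mat (A x) - mat ((T.S j).cocycle a x)‖ ≤ 2 * T.e j)
    {j : ℕ} (hj : 2 * T.e (j + 1) ≤ δ) (hB : ∀ θ, ‖mat (B θ) - mat (A (θ i))‖ ≤ δ)
    {t s : ℝ} (ht : 0 ≤ t) (hs : 0 ≤ s)
    (hts : ‖mat (ell ((κ - 1) / 2 * Real.log (T.σ j) - t) (T.σ j ^ κ))‖ ≤ 1 + s) :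
    lyapunov α B ≤ s + 2 * T.K j ^ 2 * Real.exp (2 * t) * δ := by
  have hst := T.isStep j
  set K := T.K j
  have hK : 1 ≤ K := hst.isBound.one_le
  have hδ : 0 < δ := lt_of_lt_of_le (by linarith [T.e_pos (j + 1)]) hj
  set W : Torus d → SL(2, ℝ) := fun θ => (T.S j).Z (θ i) * hyp t with hWdef
  have ht1 : ‖mat (hyp t)‖ ≤ Real.exp t := by
    have := norm_hyp_le (u := t)
    rwa [abs_of_nonneg ht] at this
  have ht2 : ‖mat (hyp t)⁻¹‖ ≤ Real.exp t := by
    have := norm_hyp_le (u := -t)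
    rwa [abs_neg, abs_of_nonneg ht, ← hyp_inv] at this
  have hW : ∀ θ, ‖mat (W θ)‖ ≤ K * Real.exp t := fun θ =>
    (norm_mat_mul_le _ _).trans (mul_le_mul (hst.isBound.real _) ht1 (norm_nonneg _) (by linarith))
  have hW' : ∀ θ, ‖mat (W θ)⁻¹‖ ≤ K * Real.exp t := fun θ => by
    rw [hWdef, mul_inv_rev, mul_comm K]
    exact (norm_mat_mul_le _ _).trans
      (mul_le_mul ht2 (hst.isBound.real_inv _) (norm_nonneg _) (Real.exp_pos _).le)
  set r : ℝ := s + 2 * K ^ 2 * Real.exp (2 * t) * δ with hr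
  have hr0 : 0 ≤ r := by positivity
  refine (lyapunov_le_log_of_conj α B W (r := 1 + r) (by linarith) hW hW' fun θ => ?_).trans
    ((Real.log_le_sub_one_of_pos (by linarith)).trans (by linarith))
  have hmain : (W (θ + α))⁻¹ * (T.S (j + 1)).cocycle a (θ i) * W θ =
      ell ((κ - 1) / 2 * Real.log (T.σ j) - t) (T.σ j ^ κ) := by
    rw [← conj_ell, hst.cocycle, hWdef, stepEll, hα]
    simp only [Pi.add_apply]
    group
  have hsplit : mat ((W (θ + α))⁻¹ * B θ * W θ) =
      mat (ell ((κ - 1) / 2 * Real.log (T.σ j) - t) (T.σ j ^ κ)) +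
        mat (W (θ + α))⁻¹ * (mat (B θ) - mat ((T.S (j + 1)).cocycle a (θ i))) * mat (W θ) := by
    rw [← hmain]
    simp only [mat, Matrix.SpecialLinearGroup.coe_mul]
    noncomm_ring
  have hdiff : ‖mat (B θ) - mat ((T.S (j + 1)).cocycle a (θ i))‖ ≤ 2 * δ := by
    have := norm_sub_le_norm_sub_add_norm_sub (mat (B θ)) (mat (A (θ i)))
      (mat ((T.S (j + 1)).cocycle a (θ i)))
    linarith [hB θ, hA (j + 1) (θ i)]
  have hexp : Real.exp (2 * t) = Real.exp t * Real.exp t := by rw [← Real.exp_add]; ring_nf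
  rw [hsplit]
  refine (norm_add_le _ _).trans ((add_le_add hts
    (norm_mul_mul_le (hW' _) hdiff (hW _))).trans (le_of_eq ?_))
  rw [hr, hexp]
  ring

theorem lyapunov_le_of_stage (hκ : 1 / 2 < κ) (hκ' : κ < 1) (hα : (a : UnitAddCircle) = α i)
    (hA : ∀ j x, ‖mat (A x) - mat ((T.S j).cocycle a x)‖ ≤ 2 * T.e j)
    {j : ℕ} (hj : 2 * T.e (j + 1) ≤ δ) (hδ1 : δ ≤ 1) (hB : ∀ θ, ‖mat (B θ) - mat (A (θ i))‖ ≤ δ) :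
    lyapunov α B ≤ 3 * T.K j ^ 2 * δ ^ κ := by
  have hst := T.isStep j
  have hK : 1 ≤ T.K j ^ 2 := one_le_pow₀ hst.isBound.one_le
  have hδ : 0 < δ := lt_of_lt_of_le (by linarith [T.e_pos (j + 1)]) hj
  have hσ := hst.pos
  have hδκ : 0 < δ ^ κ := Real.rpow_pos_of_pos hδ κ
  have hδ' : δ ^ (κ - 1) * δ = δ ^ κ := by
    rw [← Real.rpow_add_one hδ.ne']
    ring_nf
  have hexp := exp_two_mul_log (κ := κ) hδ
  rcases le_total (T.σ j) δ with hle | hle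
  -- Perturbation coarser than `σ j`: the frame has `e^{2t} = δ ^ (κ - 1)`, and the elliptic part
  -- exceeds norm `1` by at most `σ ^ (2κ-1) / δ ^ (κ-1) ≤ δ ^ κ`.
  · have hlog : Real.log (T.σ j) ≤ Real.log δ := Real.log_le_log hσ hle
    have hs : Real.exp (2 * ((κ - 1) / 2 * Real.log (T.σ j) - (κ - 1) / 2 * Real.log δ)) *
        T.σ j ^ κ ≤ δ ^ κ := by
      have h1 : T.σ j ^ (2 * κ - 1) ≤ δ ^ (2 * κ - 1) :=
        Real.rpow_le_rpow hσ.le hle (by linarith)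
      have h2 : δ ^ (2 * κ - 1) = δ ^ κ * δ ^ (κ - 1) := by
        rw [← Real.rpow_add hδ]
        ring_nf
      rw [mul_sub, Real.exp_sub, hexp, div_mul_eq_mul_div, exp_two_mul_log_mul hσ,
        div_le_iff₀ (Real.rpow_pos_of_pos hδ _), ← h2]
      exact h1
    have hell := norm_ell_le (u := (κ - 1) / 2 * Real.log (T.σ j) - (κ - 1) / 2 * Real.log δ)
      (φ := T.σ j ^ κ) (by nlinarith) (Real.rpow_nonneg hσ.le _)
    have := T.lyapunov_le_of_frame hα hA hj hB (log_scale_nonneg hκ' hδ hδ1) hδκ.le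
      (hell.trans (add_le_add le_rfl hs))
    rw [hexp] at this
    calc _ ≤ δ ^ κ + 2 * T.K j ^ 2 * (δ ^ (κ - 1) * δ) := by linarith
      _ ≤ _ := by rw [hδ']; nlinarith
  -- Perturbation finer than `σ j`: the full frame turns the elliptic part into a rotation of norm
  -- at most `1`, and `κ < 1` gives `σ ^ (κ - 1) ≤ δ ^ (κ - 1)`.
  · have hell : ‖mat (ell ((κ - 1) / 2 * Real.log (T.σ j) - (κ - 1) / 2 * Real.log (T.σ j))
        (T.σ j ^ κ))‖ ≤ 1 + 0 := by
      have h0 : hyp 0 = 1 := Subtype.ext (by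
        ext i j; fin_cases i <;> fin_cases j <;> simp [hyp])
      rw [sub_self, ell, h0, one_mul, inv_one, mul_one, add_zero]
      exact norm_rot_le _
    have := T.lyapunov_le_of_frame hα hA hj hB (log_scale_nonneg hκ' hσ hst.lt_one.le) le_rfl hell
    rw [exp_two_mul_log hσ] at this
    have h1 : T.σ j ^ (κ - 1) ≤ δ ^ (κ - 1) :=
      Real.rpow_le_rpow_of_nonpos hδ hle (by linarith)
    have h2 : T.σ j ^ (κ - 1) * δ ≤ δ ^ κ := hδ' ▸ mul_le_mul_of_nonneg_right h1 hδ.le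
    nlinarith

theorem lyapunov_le_rpow (hκ : 1 / 2 < κ) (hκ' : κ < 1) (hα : (a : UnitAddCircle) = α i)
    (hA : ∀ j x, ‖mat (A x) - mat ((T.S j).cocycle a x)‖ ≤ 2 * T.e j) {c : ℝ} (hc : c < κ) :
    ∃ δ₀ > 0, ∀ (B : C(Torus d, SL(2, ℝ))) (δ : ℝ), 0 < δ → δ < δ₀ →
      (∀ θ, ‖mat (B θ) - mat (A (θ i))‖ ≤ δ) → lyapunov α B ≤ δ ^ c := by
  set η := (κ - c) / 2 with hηdef
  have hη : 0 < η := by rw [hηdef]; linarith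
  obtain ⟨N, hN⟩ := exists_nat_one_div_lt hη
  have hlim : Tendsto (fun δ : ℝ => 3 * 2 ^ η * δ ^ η) (𝓝 0) (𝓝 0) := by
    have h1 := (Real.continuousAt_rpow_const 0 η (Or.inr hη.le)).tendsto.const_mul (3 * 2 ^ η)
    rwa [Real.zero_rpow hη.ne', mul_zero] at h1
  obtain ⟨δ₁, hδ₁, hδ₁'⟩ := Metric.eventually_nhds_iff.1 (hlim.eventually (gt_mem_nhds one_pos))
  -- The bound `2 * T.e N` forces the stage `j` below to satisfy `j ≥ N`, so the exponent in
  -- `growth` is at most `η`.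
  refine ⟨min δ₁ (min 1 (2 * T.e N)), lt_min hδ₁ (lt_min one_pos (by linarith [T.e_pos N])), ?_⟩
  intro B δ hδ hδ₀ hB
  have hδ1 : δ < 1 := hδ₀.trans_le ((min_le_right _ _).trans (min_le_left _ _))
  have hδN : δ < 2 * T.e N := hδ₀.trans_le ((min_le_right _ _).trans (min_le_right _ _))
  have hsmall : 3 * 2 ^ η * δ ^ η < 1 := hδ₁' (by
    rw [Real.dist_eq, sub_zero, abs_of_pos hδ]
    exact hδ₀.trans_le (min_le_left _ _))
  have he : Tendsto (fun j => 2 * T.e j) atTop (𝓝 0) := by simpa using T.tendsto_e.const_mul 2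
  have hex : ∃ j, 2 * T.e j ≤ δ := ((he.eventually (gt_mem_nhds hδ)).exists).imp fun j hj => hj.le
  have hfind := Nat.find_spec hex
  have hgt : N < Nat.find hex := by
    by_contra hcon
    linarith [T.e_antitone (not_lt.1 hcon)]
  obtain ⟨j, hj⟩ := Nat.exists_eq_add_one_of_ne_zero (show Nat.find hex ≠ 0 by omega)
  have hmin : δ < 2 * T.e j := not_le.1 (Nat.find_min hex (m := j) (by omega))
  rw [hj] at hfind
  have hmain := T.lyapunov_le_of_stage hκ hκ' hα hA hfind hδ1.le hB
  have hp : 1 / ((j : ℝ) + 1) ≤ η := by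
    refine le_trans ?_ hN.le
    have : (N : ℝ) ≤ j := by exact_mod_cast (by omega : N ≤ j)
    gcongr
  have hgrow : T.K j ^ 2 * (δ / 2) ^ η ≤ 1 := by
    refine le_trans (mul_le_mul_of_nonneg_left ?_ (sq_nonneg _)) (T.isStep j).growth
    calc (δ / 2) ^ η ≤ (δ / 2) ^ (1 / ((j : ℝ) + 1)) :=
          Real.rpow_le_rpow_of_exponent_ge (by linarith) (by linarith) hp
      _ ≤ T.e j ^ (1 / ((j : ℝ) + 1)) :=
          Real.rpow_le_rpow (by linarith) (by linarith) (by positivity)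
  -- Since `κ = c + 2 η`, one factor `δ ^ η` absorbs `K ^ 2` and the other absorbs the constant `3 *
  -- 2 ^ η`.
  have h2 : δ ^ κ = (δ / 2) ^ η * 2 ^ η * (δ ^ η * δ ^ c) := by
    rw [← Real.mul_rpow (by linarith) (by norm_num), div_mul_cancel₀ _ (two_ne_zero),
      ← Real.rpow_add hδ, ← Real.rpow_add hδ]
    congr 1
    rw [hηdef]
    ring
  have hδc : 0 < δ ^ c := Real.rpow_pos_of_pos hδ c
  have hX : 0 < 3 * 2 ^ η * δ ^ η := by positivity
  calc lyapunov α B ≤ 3 * T.K j ^ 2 * δ ^ κ := hmain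
    _ = (T.K j ^ 2 * (δ / 2) ^ η) * ((3 * 2 ^ η * δ ^ η) * δ ^ c) := by rw [h2]; ring
    _ ≤ 1 * (1 * δ ^ c) := by gcongr
    _ = δ ^ c := by ring

end Upper

/-! ### The lower bound -/

/-- Replacing the elliptic factor by a constant hyperbolic `g` keeps the cocycle conjugate to a
constant, so its iterates grow like the powers of `g`. -/
theorem exists_hyperbolic_perturbation (hκ : 1 / 2 < κ) (hκ' : κ < 1) {α : Torus d} {i : Fin d}
    (hα : (a : UnitAddCircle) = α i) {A : C(UnitAddCircle, SL(2, ℝ))}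
    (hA : ∀ j x, ‖mat (A x) - mat ((T.S j).cocycle a x)‖ ≤ 2 * T.e j) (j : ℕ) :
    ∃ B : C(Torus d, SL(2, ℝ)), T.σ j ^ κ / 2 ≤ lyapunov α B ∧
      ∀ θ, ‖mat (B θ) - mat (A (θ i))‖ ≤ 17 * T.K j ^ 2 * T.σ j := by
  have hst := T.isStep j
  have hκ0 : 0 < κ := by linarith
  have hσ := hst.pos
  have hK := hst.isBound.one_le
  set Z := (T.S j).Z
  set g := stepEll κ (T.σ j) * lower (-4 * T.σ j) with hg
  set φ := T.σ j ^ κ with hφdef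
  have hφ : 0 < φ := Real.rpow_pos_of_pos hσ κ
  have hφ' : φ ≤ 1 := Real.rpow_le_one hσ.le hst.lt_one.le hκ0.le
  let B : C(Torus d, SL(2, ℝ)) := ⟨fun θ => Z (θ i + a) * g * (Z (θ i))⁻¹,
    ((Z.continuous.comp ((continuous_apply i).add continuous_const)).mul continuous_const).mul
      (Z.continuous.comp (continuous_apply i)).inv⟩
  have hBθ : ∀ θ, B θ = Z (θ i + a) * g * (Z (θ i))⁻¹ := fun θ => rfl
  have hiter : ∀ (n : ℕ) (θ : Torus d), iter α B n θ = Z ((θ + n • α) i) * g ^ n * (Z (θ i))⁻¹ := by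
    intro n θ
    induction n with
    | zero => simp [iter]
    | succ n ih =>
      have h1 : (θ + (n + 1) • α) i = (θ + n • α) i + a := by
        rw [hα, add_smul, one_smul, ← add_assoc, Pi.add_apply (θ + n • α)]
      rw [iter, ih, hBθ, h1, pow_succ']
      group
  refine ⟨B, ?_, fun θ => ?_⟩
  · have h1 : Real.log (1 + φ) ≤ lyapunov α B := by
      refine log_le_lyapunov α B (c := (T.K j ^ 2)⁻¹) (by positivity) (by linarith) fun n θ => ?_
      have h2 := pow_le_norm_pow_of_trace hφ.le
        (trace_stepEll_mul_lower hκ0 hσ hst.lt_one.le) n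
      have h3 : g ^ n = (Z ((θ + n • α) i))⁻¹ * iter α B n θ * Z (θ i) := by
        rw [hiter]
        group
      have h4 : ‖mat (g ^ n)‖ ≤ T.K j * ‖mat (iter α B n θ)‖ * T.K j := by
        rw [h3, mat, Matrix.SpecialLinearGroup.coe_mul, Matrix.SpecialLinearGroup.coe_mul]
        exact norm_mul_mul_le (hst.isBound.real_inv _) le_rfl (hst.isBound.real _)
      rw [inv_mul_le_iff₀ (by positivity)]
      exact (h2.trans h4).trans (le_of_eq (by ring))
    refine le_trans ?_ h1
    refine le_trans ?_ (Real.one_sub_inv_le_log_of_pos (by linarith))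
    have h5 : 1 - (1 + φ)⁻¹ = φ / (1 + φ) := by
      field_simp
      ring
    rw [h5]
    exact div_le_div_of_nonneg_left hφ.le (by linarith) (by linarith)
  · have h1 : mat (B θ) - mat ((T.S (j + 1)).cocycle a (θ i)) = mat (Z (θ i + a)) *
        (mat (stepEll κ (T.σ j)) * (mat (lower (-4 * T.σ j)) - 1)) * mat (Z (θ i))⁻¹ := by
      rw [hBθ, hst.cocycle, hg]
      simp only [mat, Matrix.SpecialLinearGroup.coe_mul]
      noncomm_ring
    have h2 : ‖mat (stepEll κ (T.σ j))‖ ≤ 4 := by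
      have h3 := norm_stepEll_sub_one_le hκ0 hκ' hσ hst.lt_one.le
      have h4 : T.σ j ^ (2 * κ - 1) ≤ 1 := Real.rpow_le_one hσ.le hst.lt_one.le (by linarith)
      have h5 := norm_le_norm_sub_add (mat (stepEll κ (T.σ j))) 1
      rw [norm_one] at h5
      linarith
    have h3 : ‖mat (lower (-4 * T.σ j)) - 1‖ ≤ 4 * T.σ j := by
      refine norm_lower_sub_one_le.trans (le_of_eq ?_)
      rw [abs_mul, abs_of_pos hσ]
      norm_num
    have h4 : ‖mat (B θ) - mat ((T.S (j + 1)).cocycle a (θ i))‖ ≤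
        T.K j * (4 * (4 * T.σ j)) * T.K j := by
      rw [h1]
      exact norm_mul_mul_le (hst.isBound.real _) ((norm_mul_le _ _).trans
        (mul_le_mul h2 h3 (norm_nonneg _) (by norm_num))) (hst.isBound.real_inv _)
    have h5 := hA (j + 1) (θ i)
    rw [norm_sub_rev] at h5
    have h6 : T.e (j + 1) ≤ T.σ j / 2 := T.err_succ' j
    -- The constant is `17 = 16 + 1`: `4 * 4` from the perturbation, and `2 * T.e (j + 1) ≤ T.σ j`
    -- from passing to the limit.
    have h7 : T.σ j ≤ T.K j ^ 2 * T.σ j := le_mul_of_one_le_left hσ.le (one_le_pow₀ hK)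
    have h8 := norm_sub_le_norm_sub_add_norm_sub (mat (B θ))
      (mat ((T.S (j + 1)).cocycle a (θ i))) (mat (A (θ i)))
    nlinarith

theorem sigma_le_e (hκ : 1 / 2 < κ) (hκ' : κ < 1) (j : ℕ) : T.σ j ≤ T.e j := by
  have hst := T.isStep j
  have h1 : T.σ j ^ (1 : ℝ) ≤ T.σ j ^ (2 * κ - 1) :=
    Real.rpow_le_rpow_of_exponent_ge hst.pos hst.lt_one.le (by linarith)
  rw [Real.rpow_one] at h1
  have h2 : 1 ≤ T.K j ^ 2 := one_le_pow₀ hst.isBound.one_le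
  have h3 := hst.pos
  rw [e, err]
  nlinarith

theorem exists_rpow_le_lyapunov (hκ : 1 / 2 < κ) (hκ' : κ < 1) {α : Torus d} {i : Fin d}
    (hα : (a : UnitAddCircle) = α i) {A : C(UnitAddCircle, SL(2, ℝ))}
    (hA : ∀ j x, ‖mat (A x) - mat ((T.S j).cocycle a x)‖ ≤ 2 * T.e j) {c : ℝ} (hc : κ < c)
    {δ₀ : ℝ} (hδ₀ : 0 < δ₀) :
    ∃ (B : C(Torus d, SL(2, ℝ))) (δ : ℝ), δ < δ₀ ∧ (∀ θ, ‖mat (B θ) - mat (A (θ i))‖ ≤ δ) ∧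
      δ ^ c ≤ lyapunov α B ∧ 0 < lyapunov α B := by
  have hκ0 : 0 < κ := by linarith
  have hc0 : 0 < c := by linarith
  -- `q` is the midpoint of `κ / c` and `1`: `q < 1` leaves a power of `σ` to absorb `K ^ 2`, and `q
  -- * c > κ` leaves one to absorb `17 ^ c` and the factor `1 / 2`.
  set q := (1 + κ / c) / 2 with hq
  have hq0 : 0 < q := by positivity
  have hq1 : 0 < 1 - q := by
    have : κ / c < 1 := (div_lt_one hc0).2 hc
    linarith
  have hqc : q * c = κ + (c - κ) / 2 := by
    rw [hq]
    field_simp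
    ring
  have hσ0 : Tendsto T.σ atTop (𝓝 0) :=
    squeeze_zero (fun j => (T.isStep j).pos.le) (T.sigma_le_e hκ hκ') T.tendsto_e
  have hlim1 : Tendsto (fun j => 17 * T.σ j ^ q) atTop (𝓝 0) := by
    have h1 := (((Real.continuousAt_rpow_const 0 q (Or.inr hq0.le)).tendsto.comp hσ0).const_mul
      (17 : ℝ))
    rwa [Real.zero_rpow hq0.ne', mul_zero] at h1
  have hlim2 : Tendsto (fun j => (17 : ℝ) ^ c * T.σ j ^ ((c - κ) / 2)) atTop (𝓝 0) := by
    have h0 : 0 < (c - κ) / 2 := by linarith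
    have h1 := (((Real.continuousAt_rpow_const 0 _ (Or.inr h0.le)).tendsto.comp hσ0).const_mul
      ((17 : ℝ) ^ c))
    rwa [Real.zero_rpow h0.ne', mul_zero] at h1
  have hlim3 : Tendsto (fun j : ℕ => 1 / ((j : ℝ) + 1)) atTop (𝓝 0) :=
    tendsto_one_div_add_atTop_nhds_zero_nat
  obtain ⟨j, ⟨h1, h2⟩, h3⟩ := (((hlim1.eventually (gt_mem_nhds hδ₀)).and
    (hlim2.eventually (gt_mem_nhds (one_half_pos)))).and
      (hlim3.eventually (gt_mem_nhds hq1))).exists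
  obtain ⟨B, hBL, hBd⟩ := T.exists_hyperbolic_perturbation hκ hκ' hα hA j
  have hst := T.isStep j
  have hσ := hst.pos
  have hgrow : T.K j ^ 2 * T.σ j ^ (1 - q) ≤ 1 := by
    refine le_trans (mul_le_mul_of_nonneg_left ?_ (sq_nonneg _)) hst.growth
    calc T.σ j ^ (1 - q) ≤ T.σ j ^ (1 / ((j : ℝ) + 1)) :=
          Real.rpow_le_rpow_of_exponent_ge hσ hst.lt_one.le h3.le
      _ ≤ T.e j ^ (1 / ((j : ℝ) + 1)) :=
          Real.rpow_le_rpow hσ.le (T.sigma_le_e hκ hκ' j) (by positivity)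
  have hsplit : T.σ j = T.σ j ^ (1 - q) * T.σ j ^ q := by
    rw [← Real.rpow_add hσ, sub_add_cancel, Real.rpow_one]
  have hle : 17 * T.K j ^ 2 * T.σ j ≤ 17 * T.σ j ^ q := by
    have h4 : 0 < T.σ j ^ q := Real.rpow_pos_of_pos hσ q
    calc 17 * T.K j ^ 2 * T.σ j = 17 * ((T.K j ^ 2 * T.σ j ^ (1 - q)) * T.σ j ^ q) := by
          conv_lhs => rw [hsplit]
          ring
      _ ≤ 17 * (1 * T.σ j ^ q) := by gcongr
      _ = _ := by ring
  have hσκ : 0 < T.σ j ^ κ := Real.rpow_pos_of_pos hσ κ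
  refine ⟨B, 17 * T.σ j ^ q, h1, fun θ => (hBd θ).trans hle, le_trans ?_ hBL, by linarith⟩
  rw [Real.mul_rpow (by norm_num) (Real.rpow_nonneg hσ.le _), ← Real.rpow_mul hσ.le, hqc,
    Real.rpow_add hσ]
  nlinarith

end Scheme

end QPCocycle

open QPCocycle in
theorem proposition4p1 (d : ℕ) (hd : 1 ≤ d) (h : ℝ) (hh : 0 < h)
    (κ : ℝ) (hκ : 1 / 2 < κ) (hκ' : κ < 1)
    (α : QPCocycle.Torus d) (hα : QPCocycle.RationallyIndependent α)
    (ε : ℝ) (hε : 0 < ε) :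
    ∃ (A : C(QPCocycle.Torus d, Matrix.SpecialLinearGroup (Fin 2) ℝ))
      (F : (Fin d → ℂ) → Matrix (Fin 2) (Fin 2) ℂ),
      QPCocycle.IsStripExtension h A F ∧
      QPCocycle.stripNorm h (fun z => F z - 1) < ε ∧
      QPCocycle.ExactlyHolderAt κ α A := by
  have hκ0 : 0 < κ := by linarith
  set i : Fin d := ⟨0, hd⟩
  obtain ⟨a, ha⟩ : ∃ a : ℝ, (a : UnitAddCircle) = α i := QuotientAddGroup.mk_surjective _
  have hirr : ∀ m : ℤ, m ≠ 0 → m • (a : UnitAddCircle) ≠ 0 := by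
    intro m hm h0
    -- Integer vectors supported on one coordinate show that `α i` alone is irrational.
    refine hα (Pi.single i m) (by simpa using hm) ?_
    rw [Finset.sum_eq_single i (fun j _ hj => by simp [hj]) (by simp), Pi.single_eq_same, ← ha, h0]
  obtain ⟨T⟩ := nonempty_scheme (h := h) hκ (show 0 < ε / 4 by linarith) hirr
  obtain ⟨A₀, hA⟩ := T.exists_limit hκ0 hκ'
  obtain ⟨F₀, hFd, hF1, hFp, hFr⟩ := T.exists_limit_ext hκ0 hκ' hh hA
  let A : C(Torus d, SL(2, ℝ)) := ⟨fun θ => A₀ (θ i), A₀.continuous.comp (continuous_apply i)⟩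
  have hFε : ∀ z : ℂ, |z.im| < h → ‖F₀ z - 1‖ ≤ ε / 2 := fun z hz => by
    have h1 : T.e 0 ≤ ε / 4 := T.err_zero
    exact (hF1 z hz).trans (by linarith)
  refine ⟨A, fun z => F₀ (z i), ⟨?_, ⟨ε / 2 + 1, fun z hz => ?_⟩, fun z hz m => hFp _ (hz i) _,
    fun x => hFr (x i)⟩, ?_, ?_⟩
  · exact hFd.comp (differentiable_apply i).differentiableOn fun z hz => hz i
  · have h1 := norm_le_norm_sub_add (F₀ (z i)) 1
    rw [norm_one] at h1
    linarith [hFε _ (hz i)]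
  · refine lt_of_le_of_lt ?_ (half_lt_self hε)
    exact Real.iSup_le (fun z => hFε _ (z.2 i)) (by linarith)
  · have hzero : lyapunov α A = 0 := by
      refine le_antisymm ?_ (lyapunov_nonneg α A)
      -- `A` itself is an admissible `B` for every small `δ`, so its exponent lies below all `δ ^ (κ
      -- / 2)`.
      obtain ⟨δ₀, h0, hB⟩ := T.lyapunov_le_rpow hκ hκ' ha hA (half_lt_self hκ0)
      have hlim : Tendsto (fun δ : ℝ => δ ^ (κ / 2)) (𝓝[>] 0) (𝓝 0) := by
        have h1 := (Real.continuousAt_rpow_const 0 (κ / 2) (Or.inr (by linarith))).tendsto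
        rw [Real.zero_rpow (by linarith)] at h1
        exact h1.mono_left nhdsWithin_le_nhds
      refine ge_of_tendsto hlim ?_
      filter_upwards [Ioo_mem_nhdsGT h0] with δ hδ
      refine hB A δ hδ.1 hδ.2 fun θ => ?_
      have h2 : mat (A θ) - mat (A₀ (θ i)) = 0 := sub_self _
      rw [h2, norm_zero]
      exact hδ.1.le
    refine exactlyHolderAt_of_bounds α A hzero (fun c hc => ?_) fun c hc δ₀ h0 => ?_
    · obtain ⟨δ₀, h0, hB⟩ := T.lyapunov_le_rpow hκ hκ' ha hA hc
      exact ⟨δ₀, h0, fun B h1 h2 => hB B _ h1 h2 fun θ => norm_sub_le_dist₀ A B θ⟩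
    · obtain ⟨B, δ, h1, h2, h3, h4⟩ := T.exists_rpow_le_lyapunov hκ hκ' ha hA hc h0
      -- Only the exponents separate `B` from `A`: one is positive and the other is zero.
      have hne : B ≠ A := fun hBA => by rw [hBA, hzero] at h4; exact lt_irrefl _ h4
      have hd : dist₀ B A ≤ δ := dist₀_le A B h2
      have hpos := dist₀_pos hne
      exact ⟨B, hpos, hd.trans_lt h1,
        (Real.rpow_le_rpow hpos.le hd (by linarith)).trans h3⟩
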